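/- All operads are coloured symmetric operads in sets with identity operations. Let $sOp$ be the $\mathbb{N}$-coloured operad whose operations of type $(n_1,\dots,n_k;n)$ are the planar rooted trees (including the edge without vertices, of type $(;1)$) with $k$ vertices indexed bijectively by $1,\dots,k$, the $j$-th vertex having $n_j$ input edges, and with $n$ non-root leaves indexed bijectively by $1,\dots,n$. Composition is the substitution of trees into vertices. Its algebras are the single-coloured symmetric operads. Let $pOp\subset sOp$ be the suboperad of trees whose leaves are indexed in planar order. Its algebras are the planar operads. Let $uAs_{pl}$ be the terminal planar operad. Let $Sym$ be the extension functor (left adjoint to restriction) from $pOp$-algebras to $sOp$-algebras along the inclusion $pOp\to sOp$, and let $uAs=Sym(uAs_{pl})$. For an algebra $A$ over a $C$-coloured operad $Q$ let $TO(A)$ be the coproduct of $A$ and of the free $Q$-algebra on the underlying coloured set of $A$, whose generators are called variables. Let $EO(A)$ be the coproduct of $A$ and of the free $Q$-algebra on one variable $h_c$ of each colour $c\in C$. The twisted arrow category $\mathrm{Tw}_Q(A)$ has the elements of $A$ as objects. Its morphisms $a\to b$ are the elements of $TO(A)$ whose multiset of variables is $\{a\}$ and whose evaluation in $A$ is equal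 to $b$. The enveloping category $\mathcal{U}_Q(A)$ has the colours as objects. Its morphisms $c\to d$ are the elements of $EO(A)$ of colour $d$ whose multiset of variables is $\{h_c\}$. In both categories the composite $y\circ x$ is obtained by substituting $x$ for the variable of $y$. A morphism of operads $f:Q\to R$ that is the identity on colours, together with a morphism of $Q$-algebras $g:A\to f^*B$, induces a functor $\mathrm{Tw}_Q(A)\to \mathrm{Tw}_R(B)$, which sends the class of $q(a,a_1,\dots,a_n)$, with variable $a$, to the class of $f(q)(g(a),g(a_1),\dots,g(a_n))$, with variable $g(a)$. Then: 1. The categories $\mathrm{Tw}_{pOp}(uAs_{pl})$ and $\mathcal{U}_{pOp}(uAs_{pl})$ are both isomorphic to the simplex category $\Delta$. 2. For any planar operad $P$ the functor $\mathrm{Tw}_{pOp}(P)\to \mathrm{Tw}_{sOp}(Sym(P))$, induced by the inclusion $pOp\to sOp$ and by the canonical map from $P$ to $Sym(P)$, is an equivalence of categories. 3. In particular, the category $\mathrm{Tw}_{sOp}(uAs)$ is equivalent to $\Delta$. -/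

import Mathlib

open CategoryTheory

universe u u' v v' v₁ v₂ w w' w'' s s'

namespace TwArr

/-! ## Coloured symmetric operads in sets, indexed by finite sets of inputs -/

/-- The bijection that forgets the trivial coordinate of `Σ _ : Unit, I`. -/
def unitSigma (I : Type) : (Σ _ : Unit, I) ≃ I where
  toFun x := x.2
  invFun i := ⟨(), i⟩
  left_inv _ := rfl
  right_inv _ := rfl

/-- The bijection that forgets the trivial coordinate of `Σ _ : I, Unit`. -/
def sigmaUnit (I : Type) : (Σ _ : I, Unit) ≃ I where
  toFun x := x.1
  invFun i := ⟨i, ()⟩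
  left_inv _ := rfl
  right_inv _ := rfl

/-- A `C`-coloured symmetric operad in sets. The inputs of an operation are indexed by an
arbitrary finite set `I`, and `c i` is the colour of the input `i`; the symmetric groups act
by relabelling of inputs along bijections. For `I = {1, …, n}` these are the sets
`Q(c₁, …, cₙ; d)`. -/
structure Operad (C : Type u) where
  /-- operations with input colours `c` and with output colour `d` -/
  Op : ∀ {I : Type} [Finite I], (I → C) → C → Type v
  /-- identity operations -/
  one : ∀ c : C, Op (fun _ : Unit => c) c
  /-- simultaneous composition at all inputs -/
  comp : ∀ {I : Type} [Finite I] {J : I → Type} [∀ i, Finite (J i)] {c : I → C}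
    {b : ∀ i, J i → C} {d : C}, Op c d → (∀ i, Op (b i) (c i)) →
      Op (fun x : (Σ i, J i) => b x.1 x.2) d
  /-- the action of bijections on inputs -/
  relabel : ∀ {I J : Type} [Finite I] [Finite J] (e : I ≃ J) (c : J → C) {d : C},
    Op (fun i => c (e i)) d → Op c d
  relabel_refl : ∀ {I : Type} [Finite I] (c : I → C) {d : C} (q : Op c d),
    relabel (Equiv.refl I) c q = q
  relabel_trans : ∀ {I J K : Type} [Finite I] [Finite J] [Finite K] (e : I ≃ J) (e' : J ≃ K)
    (c : K → C) {d : C} (q : Op (fun i => c (e' (e i))) d),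
    relabel e' c (relabel e (fun j => c (e' j)) q) = relabel (e.trans e') c q
  one_comp : ∀ {I : Type} [Finite I] (c : I → C) {d : C} (q : Op c d),
    relabel (unitSigma I) c (comp (one d) (fun _ => q)) = q
  comp_one : ∀ {I : Type} [Finite I] (c : I → C) {d : C} (q : Op c d),
    relabel (sigmaUnit I) c (comp q (fun i => one (c i))) = q
  comp_assoc : ∀ {I : Type} [Finite I] {J : I → Type} [∀ i, Finite (J i)]
    {K : ∀ i, J i → Type} [∀ i j, Finite (K i j)] {c : I → C} {b : ∀ i, J i → C}
    {a : ∀ i j, K i j → C} {d : C} (p : Op c d) (q : ∀ i, Op (b i) (c i))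
    (r : ∀ i j, Op (a i j) (b i j)),
    relabel (Equiv.sigmaAssoc K) (fun x : (Σ i, Σ j, K i j) => a x.1 x.2.1 x.2.2)
      (comp (comp p q) (fun x => r x.1 x.2)) = comp p (fun i => comp (q i) (r i))
  relabel_comp : ∀ {I I' : Type} [Finite I] [Finite I'] (e : I ≃ I') {J : I' → Type}
    [∀ i, Finite (J i)] {c : I' → C} {b : ∀ i, J i → C} {d : C}
    (p : Op (fun i => c (e i)) d) (q : ∀ i, Op (b i) (c i)),
    comp (relabel e c p) q =
      relabel (Equiv.sigmaCongrLeft (β := J) e) (fun x : (Σ i, J i) => b x.1 x.2)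
        (comp p (fun i => q (e i)))
  comp_relabel : ∀ {I : Type} [Finite I] {J J' : I → Type} [∀ i, Finite (J i)]
    [∀ i, Finite (J' i)] (e : ∀ i, J i ≃ J' i) {c : I → C} {b : ∀ i, J' i → C} {d : C}
    (p : Op c d) (q : ∀ i, Op (fun j => b i (e i j)) (c i)),
    comp p (fun i => relabel (e i) (b i) (q i)) =
      relabel (Equiv.sigmaCongrRight e) (fun x : (Σ i, J' i) => b x.1 x.2) (comp p q)

/-- A morphism of `C`-coloured operads that is the identity on colours. -/
structure OperadHom {C : Type u} (Q : Operad.{u, v} C) (R : Operad.{u, v'} C) where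
  app : ∀ {I : Type} [Finite I] {c : I → C} {d : C}, Q.Op c d → R.Op c d
  app_one : ∀ c : C, app (Q.one c) = R.one c
  app_comp : ∀ {I : Type} [Finite I] {J : I → Type} [∀ i, Finite (J i)] {c : I → C}
    {b : ∀ i, J i → C} {d : C} (p : Q.Op c d) (q : ∀ i, Q.Op (b i) (c i)),
    app (Q.comp p q) = R.comp (app p) (fun i => app (q i))
  app_relabel : ∀ {I J : Type} [Finite I] [Finite J] (e : I ≃ J) (c : J → C) {d : C}
    (q : Q.Op (fun i => c (e i)) d), app (Q.relabel e c q) = R.relabel e c (app q)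

/-- The identity morphism of an operad. -/
def OperadHom.id {C : Type u} (Q : Operad.{u, v} C) : OperadHom Q Q where
  app q := q
  app_one _ := rfl
  app_comp _ _ := rfl
  app_relabel _ _ _ _ := rfl

/-- An algebra (in sets) over a coloured operad. -/
structure OpAlgebra {C : Type u} (Q : Operad.{u, v} C) where
  carrier : C → Type w
  act : ∀ {I : Type} [Finite I] {c : I → C} {d : C},
    Q.Op c d → (∀ i, carrier (c i)) → carrier d
  act_one : ∀ (c : C) (x : Unit → carrier c), act (Q.one c) x = x ()
  act_comp : ∀ {I : Type} [Finite I] {J : I → Type} [∀ i, Finite (J i)] {c : I → C}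
    {b : ∀ i, J i → C} {d : C} (p : Q.Op c d) (q : ∀ i, Q.Op (b i) (c i))
    (x : ∀ y : (Σ i, J i), carrier (b y.1 y.2)),
    act (Q.comp p q) x = act p (fun i => act (q i) (fun j => x ⟨i, j⟩))
  act_relabel : ∀ {I J : Type} [Finite I] [Finite J] (e : I ≃ J) (c : J → C) {d : C}
    (q : Q.Op (fun i => c (e i)) d) (x : ∀ j, carrier (c j)),
    act (Q.relabel e c q) x = act q (fun i => x (e i))

/-- A morphism of algebras over a coloured operad. -/
structure OpAlgHom {C : Type u} {Q : Operad.{u, v} C} (A : OpAlgebra.{u, v, w} Q)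
    (B : OpAlgebra.{u, v, w'} Q) where
  app : ∀ {c : C}, A.carrier c → B.carrier c
  app_act : ∀ {I : Type} [Finite I] {c : I → C} {d : C} (q : Q.Op c d)
    (x : ∀ i, A.carrier (c i)), app (A.act q x) = B.act q (fun i => app (x i))

namespace OpAlgHom

variable {C : Type u} {Q : Operad.{u, v} C}

/-- The identity morphism of an algebra. -/
def id (A : OpAlgebra.{u, v, w} Q) : OpAlgHom A A where
  app x := x
  app_act _ _ := rfl

/-- Composition of morphisms of algebras (first `g`, then `h`). -/
def comp {A : OpAlgebra.{u, v, w} Q} {B : OpAlgebra.{u, v, w'} Q} {D : OpAlgebra.{u, v, w''} Q}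
    (g : OpAlgHom A B) (h : OpAlgHom B D) : OpAlgHom A D where
  app x := h.app (g.app x)
  app_act q x := by rw [g.app_act, h.app_act]

end OpAlgHom

/-- The restriction of an algebra along a morphism of operads. -/
def OpAlgebra.res {C : Type u} {Q : Operad.{u, v} C} {R : Operad.{u, v'} C} (f : OperadHom Q R)
    (B : OpAlgebra.{u, v', w} R) : OpAlgebra.{u, v, w} Q where
  carrier := B.carrier
  act q x := B.act (f.app q) x
  act_one c x := by rw [f.app_one, B.act_one]
  act_comp p q x := by rw [f.app_comp, B.act_comp]
  act_relabel e c d q x := by rw [f.app_relabel, B.act_relabel]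

/-- The restriction of a morphism of algebras along a morphism of operads. -/
def OpAlgHom.res {C : Type u} {Q : Operad.{u, v} C} {R : Operad.{u, v'} C} (f : OperadHom Q R)
    {A : OpAlgebra.{u, v', w} R} {B : OpAlgebra.{u, v', w'} R} (g : OpAlgHom A B) :
    OpAlgHom (A.res f) (B.res f) where
  app x := g.app x
  app_act q x := g.app_act (f.app q) x

/-- The terminal algebra: one element of each colour. -/
def terminalAlgebra {C : Type u} (Q : Operad.{u, v} C) : OpAlgebra.{u, v, w} Q where
  carrier _ := PUnit
  act _ _ := PUnit.unit
  act_one _ _ := rfl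
  act_comp _ _ _ := rfl
  act_relabel _ _ _ _ _ := rfl

/-- The algebra with the same set `M` of elements in each colour, on which every operation
acts by addition in the commutative monoid `M`. -/
noncomputable def sumAlgebra {C : Type u} (Q : Operad.{u, v} C) (M : Type w) [AddCommMonoid M] :
    OpAlgebra.{u, v, w} Q where
  carrier _ := M
  act _ x := ∑ᶠ i, x i
  act_one _ x := by simp [finsum_eq_sum_of_fintype]
  act_comp {I _ J _ c b d} p q x := by
    let _ := Fintype.ofFinite I
    let _ := fun i => Fintype.ofFinite (J i)
    simp only [finsum_eq_sum_of_fintype]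
    exact Fintype.sum_sigma _
  act_relabel e c d q x := (finsum_comp_equiv e (f := x)).symm

/-! ## Algebras generated by variables and by an algebra

For a morphism of operads `f : Q → R`, a `Q`-algebra `A` and a `C`-coloured set `S` of variables,
`Adj f S A` is the `R`-algebra generated by `S` and by the elements of `A`, modulo the relations
that hold in `A`. For `f = id` it is the coproduct of the free algebra `F(S)` and `A`; for
empty `S` it is the extension of `A` along `f`. -/

section Adj

variable {C : Type u} {Q : Operad.{u, v} C} {R : Operad.{u, v'} C}

/-- Formal expressions `q(x₁, …, xₙ)` with `q` an operation of `R`, where each `xᵢ` is a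
variable (`Sum.inl`) or an element of `A` (`Sum.inr`). -/
structure Expr (R : Operad.{u, v'} C) (S : C → Type s) (A : C → Type w) (d : C) where
  I : Type
  fin : Finite I
  col : I → C
  op : R.Op col d
  arg : ∀ i, S (col i) ⊕ A (col i)

attribute [instance] Expr.fin

/-- `Evaluates A r y x` says that the subexpression `r(y)` may be replaced by `x`: either
`r(y)` contains only elements of `A`, and `x` is its value in `A`, or `r` is an identity
operation and `y = x` is a variable. -/
inductive Evaluates (S : C → Type s) (A : OpAlgebra.{u, v, w} Q) :
    ∀ {J : Type} [Finite J] {b : J → C} {c : C}, Q.Op b c →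
      (∀ j, S (b j) ⊕ A.carrier (b j)) → S c ⊕ A.carrier c → Prop
  | var {c : C} (t : S c) : Evaluates S A (Q.one c) (fun _ => Sum.inl t) (Sum.inl t)
  | const {J : Type} [Finite J] {b : J → C} {c : C} (r : Q.Op b c) (a : ∀ j, A.carrier (b j)) :
      Evaluates S A r (fun j => Sum.inr (a j)) (Sum.inr (A.act r a))

/-- The generating relation between expressions: an expression `q(x₁, …, xₙ)`, in which each
`xᵢ` is the value of a subexpression `rᵢ(zᵢ₁, zᵢ₂, …)`, is related to the expression
`q(r₁, …, rₙ)(z₁₁, z₁₂, …)`, with inputs relabelled along an arbitrary bijection `e`. -/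
inductive Step (f : OperadHom Q R) (S : C → Type s) (A : OpAlgebra.{u, v, w} Q) {d : C} :
    Expr R S A.carrier d → Expr R S A.carrier d → Prop
  | mk {I : Type} [Finite I] {J : I → Type} [∀ i, Finite (J i)] {K : Type} [Finite K]
      (e : (Σ i, J i) ≃ K) (c : I → C) (b : K → C) (q : R.Op c d)
      (r : ∀ i, Q.Op (fun j => b (e ⟨i, j⟩)) (c i))
      (x : ∀ i, S (c i) ⊕ A.carrier (c i)) (z : ∀ k, S (b k) ⊕ A.carrier (b k))
      (h : ∀ i, Evaluates S A (r i) (fun j => z (e ⟨i, j⟩)) (x i)) :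
      Step f S A ⟨I, inferInstance, c, q, x⟩
        ⟨K, inferInstance, b, R.relabel e b (R.comp q (fun i => f.app (r i))), z⟩

/-- Equivalence classes of expressions, for the equivalence relation generated by `Step`. -/
def AdjCarrier (f : OperadHom Q R) (S : C → Type s) (A : OpAlgebra.{u, v, w} Q) (d : C) :
    Type (max 1 u v' s w) :=
  Quot (Step f S A (d := d))

variable {f : OperadHom Q R} {S : C → Type s} {A : OpAlgebra.{u, v, w} Q}

/-- Application of an operation to a family of expressions. -/
def plug {I : Type} [Finite I] {c : I → C} {d : C} (q : R.Op c d)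
    (E : ∀ i, Expr R S A.carrier (c i)) : Expr R S A.carrier d :=
  ⟨Σ i, (E i).I, inferInstance, fun x => (E x.1).col x.2, R.comp q (fun i => (E i).op),
    fun x => (E x.1).arg x.2⟩

theorem Evaluates.refl {c : C} (x : S c ⊕ A.carrier c) :
    Evaluates S A (Q.one c) (fun _ => x) x := by
  rcases x with t | a
  · exact .var t
  · have := Evaluates.const (S := S) (A := A) (Q.one c) (fun _ => a)
    rwa [A.act_one] at this

theorem step_relabel {I J : Type} [Finite I] [Finite J] (e : I ≃ J) (b : J → C) {d : C}
    (q : R.Op (fun i => b (e i)) d) (z : ∀ j, S (b j) ⊕ A.carrier (b j)) :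
    Step f S A ⟨I, inferInstance, fun i => b (e i), q, fun i => z (e i)⟩
      ⟨J, inferInstance, b, R.relabel e b q, z⟩ := by
  have h := Step.mk (f := f) (A := A) (S := S) (J := fun _ : I => Unit)
    ((sigmaUnit I).trans e) (fun i => b (e i)) b q (fun i => Q.one (b (e i)))
    (fun i => z (e i)) z (fun i => Evaluates.refl (z (e i)))
  have h1 : R.relabel ((sigmaUnit I).trans e) b (R.comp q (fun i => f.app (Q.one (b (e i))))) =
      R.relabel e b q := by
    simp only [f.app_one]
    exact (R.relabel_trans (sigmaUnit I) e b (R.comp q (fun i => R.one (b (e i))))).symm.trans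
      (congrArg (R.relabel e b) (R.comp_one (fun i => b (e i)) q))
  exact (congrArg (fun o => Step f S A ⟨I, inferInstance, fun i => b (e i), q, fun i => z (e i)⟩
    ⟨J, inferInstance, b, o, z⟩) h1).mp h

theorem Step.refl {d : C} (E : Expr R S A.carrier d) : Step f S A E E := by
  have := step_relabel (f := f) (Equiv.refl E.I) E.col E.op E.arg
  simp only [R.relabel_refl] at this
  exact this

theorem Step.exists_data {d : C} {E E' : Expr R S A.carrier d} (h : Step f S A E E') :
    ∃ (J : E.I → Type) (_ : ∀ i, Finite (J i)) (K : Type) (_ : Finite K) (e : (Σ i, J i) ≃ K)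
      (b : K → C) (r : ∀ i, Q.Op (fun j => b (e ⟨i, j⟩)) (E.col i))
      (z : ∀ k, S (b k) ⊕ A.carrier (b k)),
      (∀ i, Evaluates S A (r i) (fun j => z (e ⟨i, j⟩)) (E.arg i)) ∧
      E' = ⟨K, inferInstance, b, R.relabel e b (R.comp E.op (fun i => f.app (r i))), z⟩ := by
  cases h with
  | mk e c b q r x z h => exact ⟨_, _, _, _, e, b, r, z, h, rfl⟩

/-- Operations respect simultaneous generating relations. -/
theorem step_plug {I : Type} [Finite I] {c : I → C} {d : C} (q : R.Op c d)
    (E E' : ∀ i, Expr R S A.carrier (c i)) (h : ∀ i, Step f S A (E i) (E' i)) :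
    Step f S A (plug q E) (plug q E') := by
  choose J fJ K fK e b r z hz hE using fun i => (h i).exists_data
  obtain rfl : E' = fun i => ⟨K i, fK i, b i,
      R.relabel (e i) (b i) (R.comp (E i).op (fun j => f.app (r i j))), z i⟩ := funext hE
  have key := Step.mk (f := f) (S := S) (A := A) (I := Σ i, (E i).I)
    (J := fun p => J p.1 p.2) (K := Σ i, K i)
    ((Equiv.sigmaAssoc J).trans (Equiv.sigmaCongrRight e))
    (fun p => (E p.1).col p.2) (fun k => b k.1 k.2) (R.comp q (fun i => (E i).op))
    (fun p => r p.1 p.2) (fun p => (E p.1).arg p.2) (fun k => z k.1 k.2)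
    (fun p => hz p.1 p.2)
  have h0 := R.relabel_trans (Equiv.sigmaAssoc J) (Equiv.sigmaCongrRight e)
    (fun k : (Σ i, K i) => b k.1 k.2)
    (R.comp (R.comp q (fun i => (E i).op)) (fun p => f.app (r p.1 p.2)))
  have h1 := R.comp_assoc q (fun i => (E i).op) (fun i j => f.app (r i j))
  have h2 := R.comp_relabel e (b := b) q (fun i => R.comp (E i).op (fun j => f.app (r i j)))
  have h3 := h0.symm.trans ((congrArg (R.relabel (Equiv.sigmaCongrRight e)
    (fun k : (Σ i, K i) => b k.1 k.2)) h1).trans h2.symm)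
  exact (congrArg (fun o => Step f S A (plug q E)
    ⟨Σ i, K i, inferInstance, fun k => b k.1 k.2, o, fun k => z k.1 k.2⟩) h3).mp key

/-- Operations respect equivalence of expressions. -/
theorem mk_plug {I : Type} [Finite I] {c : I → C} {d : C} (q : R.Op c d)
    (E E' : ∀ i, Expr R S A.carrier (c i))
    (h : ∀ i, (Quot.mk (Step f S A) (E i)) = Quot.mk (Step f S A) (E' i)) :
    (Quot.mk (Step f S A) (plug q E)) = Quot.mk (Step f S A) (plug q E') := by
  classical
  let _ := Fintype.ofFinite I
  have one_coord : ∀ (i : I) (F : ∀ i, Expr R S A.carrier (c i)) (X Y),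
      Relation.EqvGen (Step f S A) X Y →
      (Quot.mk (Step f S A) (plug q (Function.update F i X))) =
        Quot.mk (Step f S A) (plug q (Function.update F i Y)) := by
    intro i F X Y hXY
    induction hXY with
    | rel X Y hXY =>
      refine Quot.sound (step_plug q _ _ fun k => ?_)
      by_cases hk : k = i
      · subst hk
        simpa using hXY
      · simpa [Function.update_of_ne hk] using Step.refl (F k)
    | refl => rfl
    | symm _ _ _ ih => exact ih.symm
    | trans _ _ _ _ _ ih ih' => exact ih.trans ih'
  have main : ∀ t : Finset I, (Quot.mk (Step f S A) (plug q (t.piecewise E' E))) =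
      Quot.mk (Step f S A) (plug q E) := by
    intro t
    induction t using Finset.induction_on with
    | empty => simp
    | insert i t hi ih =>
      rw [Finset.piecewise_insert, ← one_coord i _ _ _ (Quot.eqvGen_exact (h i)), ← ih]
      congr 2
      rw [Function.update_eq_iff]
      simp [hi]
  simpa using (main Finset.univ).symm

theorem mk_relabel {I J : Type} [Finite I] [Finite J] (e : I ≃ J) (b : J → C) {d : C}
    (q : R.Op (fun i => b (e i)) d) (z : ∀ j, S (b j) ⊕ A.carrier (b j)) :
    Quot.mk (Step f S A) ⟨I, inferInstance, fun i => b (e i), q, fun i => z (e i)⟩ =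
      Quot.mk (Step f S A) ⟨J, inferInstance, b, R.relabel e b q, z⟩ :=
  Quot.sound (step_relabel e b q z)

/-- The `R`-algebra generated by the variables `S` and by the `Q`-algebra `A`, modulo the
relations in `A`. Operations act by substitution of expressions. -/
noncomputable def Adj (f : OperadHom Q R) (S : C → Type s) (A : OpAlgebra.{u, v, w} Q) :
    OpAlgebra.{u, v', max 1 u v' s w} R where
  carrier := AdjCarrier f S A
  act q x := Quot.mk _ (plug q (fun i => (x i).out))
  act_one c x := by
    rw [← Quot.out_eq (x ())]
    generalize hE : Quot.out (x ()) = E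
    have h := mk_relabel (f := f) (unitSigma E.I) E.col (R.comp (R.one c) (fun _ => E.op)) E.arg
    rw [R.one_comp] at h
    refine Eq.trans ?_ h
    exact mk_plug _ _ (fun _ => E) (fun i => by rw [← hE])
  act_comp {I _ J _ c b d} p q x := by
    have h := mk_relabel (f := f) (A := A)
      (Equiv.sigmaAssoc (fun i j => (x ⟨i, j⟩).out.I))
      (fun y => (x ⟨y.1, y.2.1⟩).out.col y.2.2)
      (R.comp (R.comp p q) (fun y => (x ⟨y.1, y.2⟩).out.op))
      (fun y => (x ⟨y.1, y.2.1⟩).out.arg y.2.2)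
    have h1 := R.comp_assoc p q (fun i j => (x ⟨i, j⟩).out.op)
    rw [h1] at h
    refine Eq.trans h ?_
    exact mk_plug p (fun i => plug (q i) (fun j => (x ⟨i, j⟩).out)) _
      (fun i => (Quot.out_eq _).symm)
  act_relabel {I J _ _} e c d q x := by
    have h := mk_relabel (f := f) (A := A)
      (Equiv.sigmaCongrLeft (β := fun j => (x j).out.I) e)
      (fun y => (x y.1).out.col y.2)
      (R.comp q (fun i => (x (e i)).out.op))
      (fun y => (x y.1).out.arg y.2)
    have h1 := R.relabel_comp e q (fun j => (x j).out.op)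
    rw [← h1] at h
    exact h.symm

theorem act_mk {I : Type} [Finite I] {c : I → C} {d : C} (q : R.Op c d)
    (E : ∀ i, Expr R S A.carrier (c i)) :
    (Adj f S A).act q (fun i => Quot.mk _ (E i)) = Quot.mk _ (plug q E) :=
  mk_plug q _ _ fun _ => Quot.out_eq _

namespace Adj

/-- A variable or an element of `A`, as an element of `Adj f S A`. -/
def gen (f : OperadHom Q R) {S : C → Type s} {A : OpAlgebra.{u, v, w} Q} {c : C}
    (x : S c ⊕ A.carrier c) : (Adj f S A).carrier c :=
  Quot.mk _ ⟨Unit, inferInstance, fun _ => c, R.one c, fun _ => x⟩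

/-- The element represented by a variable. -/
def var (f : OperadHom Q R) (A : OpAlgebra.{u, v, w} Q) {c : C} (t : S c) :
    (Adj f S A).carrier c :=
  gen f (Sum.inl t)

/-- The canonical morphism of `Q`-algebras from `A`. -/
noncomputable def const (f : OperadHom Q R) (S : C → Type s) (A : OpAlgebra.{u, v, w} Q) :
    OpAlgHom A ((Adj f S A).res f) where
  app a := gen f (Sum.inr a)
  app_act {I _ c d} q a := by
    have h := Quot.sound (Step.mk (f := f) (S := S) (A := A) (unitSigma I) (fun _ => d) c
      (R.one d) (fun _ => q) (fun _ => Sum.inr (A.act q a)) (fun i => Sum.inr (a i))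
      (fun _ => .const q a))
    have h1 := R.one_comp c (f.app q)
    refine (h.trans (congrArg (fun o => Quot.mk (Step f S A)
      ⟨I, inferInstance, c, o, fun i => Sum.inr (a i)⟩) h1)).trans ?_
    refine Eq.trans ?_ (act_mk (f := f) (f.app q)
      (fun i => ⟨Unit, inferInstance, fun _ => c i, R.one (c i), fun _ => Sum.inr (a i)⟩)).symm
    have h' := mk_relabel (f := f) (S := S) (A := A) (sigmaUnit I) c
      (R.comp (f.app q) (fun i => R.one (c i))) (fun i => Sum.inr (a i))
    rw [R.comp_one] at h'
    exact h'.symm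

/-- An expression is the result of applying its operation to its arguments. -/
theorem mk_eq_act {d : C} (E : Expr R S A.carrier d) :
    Quot.mk (Step f S A) E = (Adj f S A).act E.op (fun i => gen f (E.arg i)) := by
  refine Eq.trans ?_ (act_mk (f := f) E.op
      (fun i => ⟨Unit, inferInstance, fun _ => E.col i, R.one (E.col i), fun _ => E.arg i⟩)).symm
  have h' := mk_relabel (f := f) (S := S) (A := A) (sigmaUnit E.I) E.col
    (R.comp E.op (fun i => R.one (E.col i))) E.arg
  rw [R.comp_one] at h'
  exact h'.symm

/-- The universal property: a map from the variables to an `R`-algebra `B` and a morphism of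
`Q`-algebras from `A` to `B` determine a morphism of `R`-algebras. -/
noncomputable def lift {B : OpAlgebra.{u, v', w'} R} (σ : ∀ c, S c → B.carrier c)
    (g : OpAlgHom A (B.res f)) : OpAlgHom (Adj f S A) B where
  app {c} := Quot.lift (fun E : Expr R S A.carrier c =>
      B.act E.op (fun i => Sum.elim (σ _) (g.app (c := _)) (E.arg i))) (by
    intro E E' h
    obtain ⟨J, _, K, _, e, b, r, z, hz, rfl⟩ := h.exists_data
    simp only [B.act_relabel, B.act_comp]
    congr 1
    funext i
    have : ∀ {J : Type} [Finite J] {b : J → C} {c : C} {r : Q.Op b c}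
        {y : ∀ j, S (b j) ⊕ A.carrier (b j)} {x : S c ⊕ A.carrier c}, Evaluates S A r y x →
        Sum.elim (σ _) (g.app (c := _)) x =
          B.act (f.app r) (fun j => Sum.elim (σ _) (g.app (c := _)) (y j)) := by
      intro J _ b c r y x h
      cases h with
      | var t => rw [f.app_one, B.act_one]
      | const r a => exact g.app_act r a
    exact this (hz i))
  app_act {I _ c d} q x := by
    obtain ⟨E, rfl⟩ : ∃ E : ∀ i, Expr R S A.carrier (c i), x = fun i => Quot.mk _ (E i) :=
      ⟨fun i => (x i).out, funext fun i => (Quot.out_eq _).symm⟩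
    rw [act_mk]
    exact B.act_comp q (fun i => (E i).op) _

section lift

variable {B : OpAlgebra.{u, v', w'} R} (σ : ∀ c, S c → B.carrier c) (g : OpAlgHom A (B.res f))

theorem lift_gen {c : C} (x : S c ⊕ A.carrier c) :
    (lift σ g).app (gen f x) = Sum.elim (σ c) (g.app (c := c)) x :=
  B.act_one _ _

theorem lift_var {c : C} (t : S c) : (lift σ g).app (var f A t) = σ c t :=
  lift_gen σ g _

theorem lift_const {c : C} (a : A.carrier c) :
    (lift σ g).app ((const f S A).app a) = g.app a :=
  lift_gen σ g _

end lift

/-- The morphism that sends an element to the multiset of its variables. -/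
noncomputable def varsHom (f : OperadHom Q R) (S : C → Type s) (A : OpAlgebra.{u, v, w} Q) :
    OpAlgHom (Adj f S A) (sumAlgebra R (Multiset (Σ c, S c))) :=
  lift (fun c t => ({⟨c, t⟩} : Multiset (Σ c, S c)))
    { app := fun _ => (0 : Multiset (Σ c, S c))
      app_act := fun {I} _ _ _ _ _ =>
        (finsum_zero (α := I) (M := Multiset (Σ c, S c))).symm }

/-- The multiset of variables of an element. -/
noncomputable def vars {d : C} (x : (Adj f S A).carrier d) : Multiset (Σ c, S c) :=
  (varsHom f S A).app x

theorem vars_var {c : C} (t : S c) : vars (var f A t) = {⟨c, t⟩} :=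
  lift_var (B := sumAlgebra R (Multiset (Σ c, S c))) _ _ t

/-- Two morphisms that agree on `A` and on the variables of an element agree on this element. -/
theorem hom_congr {B : OpAlgebra.{u, v', w'} R} (g h : OpAlgHom (Adj f S A) B) {d : C}
    (x : (Adj f S A).carrier d)
    (hA : ∀ {c : C} (a : A.carrier c),
      g.app ((const f S A).app a) = h.app ((const f S A).app a))
    (hS : ∀ t ∈ vars x, g.app (var f A t.2) = h.app (var f A t.2)) :
    g.app x = h.app x := by
  induction x using Quot.ind with
  | mk E =>
  rw [mk_eq_act] at hS ⊢
  rw [g.app_act, h.app_act]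
  congr 1
  funext i
  generalize hi : E.arg i = y
  rcases y with t | a
  · refine hS ⟨_, t⟩ ?_
    rw [vars, OpAlgHom.app_act]
    let _ := Fintype.ofFinite E.I
    change _ ∈ ∑ᶠ i, vars (gen f (E.arg i))
    rw [finsum_eq_sum_of_fintype, Multiset.mem_sum]
    refine ⟨i, Finset.mem_univ _, ?_⟩
    rw [hi]
    change _ ∈ vars (var f A t)
    rw [vars_var]
    simp
  · exact hA a

theorem vars_const {c : C} (a : A.carrier c) :
    vars ((const f S A).app a) = (0 : Multiset (Σ c, S c)) :=
  lift_const (B := sumAlgebra R (Multiset (Σ c, S c))) _ _ a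

open Classical in
/-- Substitution of `x` for the variable `t`; the other variables are not changed. -/
noncomputable def subst (t : Σ c, S c) (x : (Adj f S A).carrier t.1) :
    OpAlgHom (Adj f S A) (Adj f S A) :=
  lift (fun c s => if h : t = ⟨c, s⟩ then cast (congrArg (fun u => (Adj f S A).carrier u.1) h) x
      else var f A s)
    (const f S A)

section subst

variable (t : Σ c, S c) (x : (Adj f S A).carrier t.1)

theorem subst_const {c : C} (a : A.carrier c) :
    (subst t x).app ((const f S A).app a) = (const f S A).app a :=
  lift_const _ _ a

theorem subst_var_self : (subst t x).app (var f A t.2) = x := by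
  rw [subst, lift_var, dif_pos rfl, cast_eq]

theorem subst_var_of_ne {c : C} (s : S c) (h : t ≠ ⟨c, s⟩) :
    (subst t x).app (var f A s) = var f A s := by
  rw [subst, lift_var, dif_neg h]

end subst

theorem subst_var (t : Σ c, S c) {d : C} (y : (Adj f S A).carrier d) :
    (subst t (var f A t.2)).app y = y := by
  refine hom_congr _ (OpAlgHom.id _) y (fun a => subst_const _ _ a) fun s _ => ?_
  by_cases h : t = s
  · subst h
    exact subst_var_self _ _
  · exact subst_var_of_ne _ _ _ h

end Adj

/-- Addition-preserving maps give morphisms of the algebras `sumAlgebra`. -/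
noncomputable def sumHom (Q : Operad.{u, v} C) {M : Type w} {N : Type w'} [AddCommMonoid M]
    [AddCommMonoid N] (φ : M →+ N) : OpAlgHom (sumAlgebra Q M) (sumAlgebra Q N) where
  app := φ
  app_act _ _ := φ.map_finsum (Set.toFinite _)

/-- Multisets, bound along a map, as an additive map. -/
def bindHom {α : Type w} {β : Type w'} (φ : α → Multiset β) : Multiset α →+ Multiset β where
  toFun m := m.bind φ
  map_zero' := Multiset.zero_bind φ
  map_add' m n := Multiset.add_bind m n φ

namespace Adj

theorem vars_hom {Q' : Operad.{u, v₁} C} {R' : Operad.{u, v₂} C} {f' : OperadHom Q' R'}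
    {S' : C → Type s'} {A' : OpAlgebra.{u, v₁, w'} Q'} (k : OperadHom R R')
    (h : OpAlgHom (Adj f S A) ((Adj f' S' A').res k))
    (φ : (Σ c, S c) → Multiset (Σ c, S' c)) {d : C} (x : (Adj f S A).carrier d)
    (hA : ∀ {c : C} (a : A.carrier c), vars (f := f') (A := A') (h.app ((const f S A).app a)) = 0)
    (hS : ∀ t ∈ vars x, vars (f := f') (A := A') (h.app (var f A t.2)) = φ t) :
    vars (f := f') (A := A') (h.app x) = (vars x).bind φ := by
  refine hom_congr (B := sumAlgebra R (Multiset (Σ c, S' c)))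
    (h.comp ((varsHom f' S' A').res k)) ((varsHom f S A).comp (sumHom R (bindHom φ))) x ?_ ?_
  · intro c a
    refine (hA a).trans ?_
    change 0 = (vars ((const f S A).app a)).bind φ
    rw [vars_const, Multiset.zero_bind]
  · intro t ht
    refine (hS t ht).trans ?_
    change _ = (vars (var f A t.2)).bind φ
    rw [vars_var, Multiset.singleton_bind]

theorem vars_subst (t : Σ c, S c) (x : (Adj f S A).carrier t.1) {d : C}
    (y : (Adj f S A).carrier d) (hy : vars y = {t}) : vars ((subst t x).app y) = vars x := by
  refine (vars_hom (f' := f) (A' := A) (OperadHom.id R) (subst t x) (fun _ => vars x) y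
    (fun a => ?_) fun u hu => ?_).trans ?_
  · exact (congrArg vars (subst_const t x a)).trans (vars_const a)
  · rw [hy, Multiset.mem_singleton] at hu
    subst hu
    exact congrArg vars (subst_var_self u x)
  · rw [hy, Multiset.singleton_bind]

theorem subst_subst (t u : Σ c, S c) (x : (Adj f S A).carrier t.1) (y : (Adj f S A).carrier u.1)
    {d : C} (z : (Adj f S A).carrier d) (hz : vars z = {u}) :
    (subst u ((subst t x).app y)).app z = (subst t x).app ((subst u y).app z) := by
  refine hom_congr _ ((subst u y).comp (subst t x)) z (fun a => ?_) fun v hv => ?_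
  · refine (subst_const _ _ a).trans ?_
    exact ((congrArg _ (subst_const u y a)).trans (subst_const t x a)).symm
  · rw [hz, Multiset.mem_singleton] at hv
    subst hv
    rw [subst_var_self]
    exact (congrArg (subst t x).app (subst_var_self v y)).symm

end Adj

end Adj

/-! ## Enveloping categories and twisted arrow categories -/

section TwistedArrow

variable {C : Type u} {Q : Operad.{u, v} C} {R : Operad.{u, v'} C}

/-- The `Q`-algebra `EO(A)`, generated by one variable of each colour and by `A`, modulo the
relations in `A`. -/
noncomputable abbrev EO (A : OpAlgebra.{u, v, w} Q) : OpAlgebra.{u, v, max 1 u v w} Q :=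
  Adj (OperadHom.id Q) (fun _ => PUnit.{1}) A

/-- The `Q`-algebra `TO(A)`, generated by two copies of `A`, modulo the relations in the second
copy of `A`. The elements of the first copy are the variables. -/
noncomputable abbrev TO (A : OpAlgebra.{u, v, w} Q) : OpAlgebra.{u, v, max 1 u v w} Q :=
  Adj (OperadHom.id Q) A.carrier A

/-- The evaluation map `TO(A) → A`, the identity on both copies of `A`. -/
noncomputable def ev (A : OpAlgebra.{u, v, w} Q) : OpAlgHom (TO A) A :=
  Adj.lift (fun _ a => a) { app := fun a => a, app_act := fun _ _ => rfl }

theorem ev_var (A : OpAlgebra.{u, v, w} Q) {c : C} (a : A.carrier c) :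
    (ev A).app (Adj.var (OperadHom.id Q) A a) = a :=
  Adj.lift_var _ _ a

theorem ev_const (A : OpAlgebra.{u, v, w} Q) {c : C} (a : A.carrier c) :
    (ev A).app ((Adj.const (OperadHom.id Q) A.carrier A).app a) = a :=
  Adj.lift_const _ _ a

/-- The objects of the enveloping category of `A`: the colours. -/
def Env (_A : OpAlgebra.{u, v, w} Q) : Type u := C

/-- The enveloping category of `A`. The morphisms from `c` to `d` are the elements of `EO(A)` of
colour `d` that contain exactly one occurrence of a variable, the variable of colour `c`. The
composite of `x : c ⟶ d` and `y : d ⟶ e` is obtained by substitution of `x` for the variable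
of `y`. -/
noncomputable instance (A : OpAlgebra.{u, v, w} Q) : Category (Env A) where
  Hom (c d : C) := {x : (EO A).carrier d // Adj.vars x = {⟨c, PUnit.unit⟩}}
  id _ := ⟨Adj.var _ A PUnit.unit, Adj.vars_var _⟩
  comp {_ d _} x y := ⟨(Adj.subst ⟨d, PUnit.unit⟩ x.1).app y.1,
    (Adj.vars_subst _ _ _ y.2).trans x.2⟩
  id_comp y := Subtype.ext (Adj.subst_var ⟨_, PUnit.unit⟩ y.1)
  comp_id {_ d} x := Subtype.ext (Adj.subst_var_self ⟨d, PUnit.unit⟩ x.1)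
  assoc _ _ z := Subtype.ext (Adj.subst_subst _ _ _ _ z.1 z.2)

/-- The objects of the twisted arrow category of `A`: the elements of `A`. -/
def Tw (A : OpAlgebra.{u, v, w} Q) : Type (max u w) := Σ c, A.carrier c

theorem ev_subst (A : OpAlgebra.{u, v, w} Q) (b : Σ c, A.carrier c) (x : (TO A).carrier b.1)
    (hx : (ev A).app x = b.2) {d : C} (y : (TO A).carrier d) :
    (ev A).app ((Adj.subst b x).app y) = (ev A).app y := by
  refine Adj.hom_congr ((Adj.subst b x).comp (ev A)) (ev A) y (fun a => ?_) fun t _ => ?_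
  · exact congrArg (ev A).app (Adj.subst_const b x a)
  · by_cases h : b = t
    · subst h
      exact (congrArg (ev A).app (Adj.subst_var_self b x)).trans (hx.trans (ev_var A _).symm)
    · exact congrArg (ev A).app (Adj.subst_var_of_ne b x t.2 h)

/-- The twisted arrow category of `A`. The morphisms from `a` to `b` are the elements of `TO(A)`
that contain exactly one occurrence of a variable, the variable `a`, and whose value in `A`
is `b`. The composite of `x : a ⟶ b` and `y : b ⟶ c` is obtained by substitution of `x` for the
variable `b` of `y`. -/
noncomputable instance (A : OpAlgebra.{u, v, w} Q) : Category (Tw A) where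
  Hom (a b : Σ c, A.carrier c) :=
    {x : (TO A).carrier b.1 // Adj.vars x = {a} ∧ (ev A).app x = b.2}
  id a := ⟨Adj.var _ A a.2, Adj.vars_var _, ev_var A _⟩
  comp {_ b _} x y := ⟨(Adj.subst b x.1).app y.1,
    (Adj.vars_subst b x.1 y.1 y.2.1).trans x.2.1, (ev_subst A b x.1 x.2.2 y.1).trans y.2.2⟩
  id_comp {a _} y := Subtype.ext (Adj.subst_var a y.1)
  comp_id {_ b} x := Subtype.ext (Adj.subst_var_self b x.1)
  assoc {_ b c _} x y z := Subtype.ext (Adj.subst_subst b c x.1 y.1 z.1 z.2.1)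

section map

variable {A : OpAlgebra.{u, v, w} Q} {B : OpAlgebra.{u, v', w'} R} (f : OperadHom Q R)
  (g : OpAlgHom A (B.res f))

/-- The map `TO(A) → TO(B)` that sends expressions `q(a, a₁, …, aₙ)` to
`f(q)(g(a), g(a₁), …, g(aₙ))`. -/
noncomputable def TO.map : OpAlgHom (TO A) ((TO B).res f) :=
  Adj.lift (fun _ a => Adj.var (OperadHom.id R) B (g.app a))
    { app := fun a => (Adj.const (OperadHom.id R) B.carrier B).app (g.app a)
      app_act := fun q x => by
        rw [g.app_act]
        exact (Adj.const (OperadHom.id R) B.carrier B).app_act (f.app q) _ }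

theorem TO.map_var {c : C} (a : A.carrier c) :
    (TO.map f g).app (Adj.var (OperadHom.id Q) A a) = Adj.var (OperadHom.id R) B (g.app a) :=
  Adj.lift_var (B := (TO B).res f) _ _ a

theorem TO.map_const {c : C} (a : A.carrier c) :
    (TO.map f g).app ((Adj.const (OperadHom.id Q) A.carrier A).app a) =
      (Adj.const (OperadHom.id R) B.carrier B).app (g.app a) :=
  Adj.lift_const (B := (TO B).res f) _ _ a

theorem TO.vars_map {d : C} (x : (TO A).carrier d) (a : Σ c, A.carrier c)
    (hx : Adj.vars x = {a}) :
    Adj.vars (f := OperadHom.id R) (A := B) ((TO.map f g).app x) = {⟨a.1, g.app a.2⟩} := by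
  refine (Adj.vars_hom f (TO.map f g) (fun t : (Σ c, A.carrier c) => {⟨t.1, g.app t.2⟩}) x (fun a => ?_)
    fun t _ => ?_).trans ?_
  · exact (congrArg _ (TO.map_const f g a)).trans (Adj.vars_const _)
  · exact (congrArg _ (TO.map_var f g t.2)).trans (Adj.vars_var _)
  · rw [hx, Multiset.singleton_bind]

theorem TO.ev_map {d : C} (x : (TO A).carrier d) :
    (ev B).app ((TO.map f g).app x) = g.app ((ev A).app x) := by
  refine Adj.hom_congr ((TO.map f g).comp ((ev B).res f)) ((ev A).comp g) x (fun a => ?_)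
    fun t _ => ?_
  · refine (congrArg (ev B).app (TO.map_const f g a)).trans ((ev_const B _).trans ?_)
    exact congrArg g.app (ev_const A a).symm
  · refine (congrArg (ev B).app (TO.map_var f g t.2)).trans ((ev_var B _).trans ?_)
    exact congrArg g.app (ev_var A t.2).symm

theorem TO.map_subst (b : Σ c, A.carrier c) (x : (TO A).carrier b.1) {d : C}
    (y : (TO A).carrier d) (hy : Adj.vars y = {b}) :
    (TO.map f g).app ((Adj.subst b x).app y) =
      (Adj.subst (f := OperadHom.id R) (A := B) ⟨b.1, g.app b.2⟩ ((TO.map f g).app x)).app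
        ((TO.map f g).app y) := by
  refine Adj.hom_congr ((Adj.subst b x).comp (TO.map f g))
    ((TO.map f g).comp ((Adj.subst (f := OperadHom.id R) (A := B) ⟨b.1, g.app b.2⟩
      ((TO.map f g).app x)).res f)) y (fun a => ?_) fun t ht => ?_
  · refine (congrArg (TO.map f g).app (Adj.subst_const b x a)).trans ?_
    refine (TO.map_const f g a).trans ?_
    refine Eq.trans ?_ (congrArg (Adj.subst (f := OperadHom.id R) (A := B)
      ⟨b.1, g.app b.2⟩ ((TO.map f g).app x)).app (TO.map_const f g a)).symm
    exact (Adj.subst_const _ _ _).symm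
  · rw [hy, Multiset.mem_singleton] at ht
    subst ht
    refine (congrArg (TO.map f g).app (Adj.subst_var_self t x)).trans ?_
    refine Eq.trans ?_ (congrArg (Adj.subst (f := OperadHom.id R) (A := B)
      ⟨t.1, g.app t.2⟩ ((TO.map f g).app x)).app (TO.map_var f g t.2)).symm
    exact (Adj.subst_var_self (f := OperadHom.id R) (A := B) ⟨t.1, g.app t.2⟩ _).symm

/-- The functor between twisted arrow categories induced by a morphism of operads `f : Q → R`
and by a morphism of `Q`-algebras `g` from `A` to the restriction of `B`. -/
noncomputable def Tw.map : Tw A ⥤ Tw B where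
  obj a := ⟨a.1, g.app a.2⟩
  map {a _} x := ⟨(TO.map f g).app x.1, TO.vars_map f g x.1 a x.2.1,
    (TO.ev_map f g x.1).trans (congrArg g.app x.2.2)⟩
  map_id a := Subtype.ext (TO.map_var f g a.2)
  map_comp {_ b _} x y := Subtype.ext (TO.map_subst f g b x.1 y.1 y.2.1)

end map

/-- The extension of a `Q`-algebra `A` along a morphism of operads `f : Q → R`: the `R`-algebra
generated by the elements of `A`, modulo the relations in `A`. It is left adjoint to
restriction. -/
noncomputable def OpAlgebra.ext (f : OperadHom Q R) (A : OpAlgebra.{u, v, w} Q) :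
    OpAlgebra.{u, v', max 1 u v' w} R :=
  Adj f (fun _ => PEmpty.{1}) A

/-- The unit `A → f^* f_! A` of the extension–restriction adjunction. -/
noncomputable def OpAlgebra.extUnit (f : OperadHom Q R) (A : OpAlgebra.{u, v, w} Q) :
    OpAlgHom A ((A.ext f).res f) :=
  Adj.const f (fun _ => PEmpty.{1}) A

/-- The universal property of the extension. -/
theorem OpAlgebra.ext_existsUnique (f : OperadHom Q R) (A : OpAlgebra.{u, v, w} Q)
    (B : OpAlgebra.{u, v', w'} R) (g : OpAlgHom A (B.res f)) :
    ∃! h : OpAlgHom (A.ext f) B,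
      ∀ (c : C) (a : A.carrier c), h.app ((A.extUnit f).app a) = g.app a := by
  refine ⟨Adj.lift (fun _ => PEmpty.elim) g, fun c a => Adj.lift_const _ g a, fun h hh => ?_⟩
  obtain ⟨app, app_act⟩ := h
  have key : ∀ {c : C} (x : (A.ext f).carrier c),
      app x = (Adj.lift (fun _ => PEmpty.elim) g : OpAlgHom (A.ext f) B).app x := fun x =>
    Adj.hom_congr ⟨app, app_act⟩ (Adj.lift (fun _ => PEmpty.elim) g) x
      (fun a => (hh _ a).trans (Adj.lift_const _ g a).symm) (fun t _ => t.2.elim)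
  generalize (Adj.lift (fun _ => PEmpty.elim) g : OpAlgHom (A.ext f) B) = k at key
  obtain ⟨app', app_act'⟩ := k
  obtain rfl : @app = @app' := by
    funext c x
    exact key x
  rfl

end TwistedArrow

/-- Two categories are isomorphic: there are mutually inverse functors between them. -/
def IsomorphicCategories (X : Type u) [Category.{v} X] (Y : Type u') [Category.{v'} Y] : Prop :=
  ∃ (F : X ⥤ Y) (G : Y ⥤ X), F ⋙ G = 𝟭 X ∧ G ⋙ F = 𝟭 Y

/-! ## Trees and the operads of planar and of symmetric operads -/

/-- Planar rooted trees, with vertices marked by elements of `I` and with leaves marked by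
elements of `L`, such that a vertex marked by `i` has `c i` input edges, in planar order.
The tree `leaf l` is the edge without vertices. -/
inductive PTree {I : Type} (c : I → ℕ) (L : Type) : Type
  | leaf (l : L) : PTree c L
  | node (i : I) (ts : Fin (c i) → PTree c L) : PTree c L

namespace PTree

variable {I J K L M N : Type}

/-- The marks of leaves, listed in planar order. -/
def leaves {c : I → ℕ} : PTree c L → List L
  | leaf l => [l]
  | node _ ts => (List.finRange _).flatMap fun j => (ts j).leaves

/-- The marks of vertices, listed in depth-first order. -/
def vertices {c : I → ℕ} : PTree c L → List I
  | leaf _ => []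
  | node i ts => i :: (List.finRange _).flatMap fun j => (ts j).vertices

/-- The tree with one vertex. -/
def corolla (c : I → ℕ) (i : I) : PTree c (Fin (c i)) := node i fun j => leaf j

/-- Change of marks of vertices. -/
def map (e : I → J) (c : J → ℕ) : PTree (fun i => c (e i)) L → PTree c L
  | leaf l => leaf l
  | node i ts => node (e i) fun j => (ts j).map e c

/-- Grafting of a tree `g l` to each leaf marked by `l`. -/
def graft {c : I → ℕ} : PTree c L → (L → PTree c M) → PTree c M
  | leaf l, g => g l
  | node i ts, g => node i fun j => (ts j).graft g

/-- Substitution of a tree `u i` into each vertex marked by `i`: the leaf `j` of `u i` is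
identified with the `j`-th input edge of the vertex. -/
def subst {c : I → ℕ} {b : J → ℕ} : PTree c L → (∀ i, PTree b (Fin (c i))) → PTree b L
  | leaf l, _ => leaf l
  | node i ts, u => (u i).graft fun j => (ts j).subst u

/-- Substitution of trees into vertices, with vertices of the result marked by pairs. -/
def comp {J : I → Type} {c : I → ℕ} {b : ∀ i, J i → ℕ} (t : PTree c L)
    (u : ∀ i, PTree (b i) (Fin (c i))) : PTree (fun x : (Σ i, J i) => b x.1 x.2) L :=
  t.subst fun i => (u i).map (fun j => (⟨i, j⟩ : Σ i, J i)) (fun x => b x.1 x.2)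

theorem map_id (c : I → ℕ) (t : PTree c L) : t.map (fun i => i) c = t := by
  induction t with
  | leaf => rfl
  | node i ts ih => simp only [map, ih]

theorem map_map (e : I → J) (e' : J → K) (c : K → ℕ) (t : PTree (fun i => c (e' (e i))) L) :
    (t.map e (fun j => c (e' j))).map e' c = t.map (fun i => e' (e i)) c := by
  induction t with
  | leaf => rfl
  | node i ts ih => simp only [map, ih]

theorem map_graft (e : I → J) (c : J → ℕ) (t : PTree (fun i => c (e i)) L)
    (g : L → PTree (fun i => c (e i)) M) :
    (t.graft g).map e c = (t.map e c).graft fun l => (g l).map e c := by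
  induction t with
  | leaf => rfl
  | node i ts ih => simp only [map, graft, ih]

theorem graft_leaf {c : I → ℕ} (t : PTree c L) : t.graft leaf = t := by
  induction t with
  | leaf => rfl
  | node i ts ih => simp only [graft, ih]

theorem graft_graft {c : I → ℕ} (t : PTree c L) (g : L → PTree c M) (h : M → PTree c N) :
    (t.graft g).graft h = t.graft fun l => (g l).graft h := by
  induction t with
  | leaf => rfl
  | node i ts ih => simp only [graft, ih]

theorem subst_graft {c : I → ℕ} {b : J → ℕ} (t : PTree c L) (g : L → PTree c M)
    (u : ∀ i, PTree b (Fin (c i))) :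
    (t.graft g).subst u = (t.subst u).graft fun l => (g l).subst u := by
  induction t with
  | leaf => rfl
  | node i ts ih => simp only [subst, graft, ih, graft_graft]

theorem subst_subst {c : I → ℕ} {b : J → ℕ} {a : K → ℕ} (t : PTree c L)
    (u : ∀ i, PTree b (Fin (c i))) (r : ∀ j, PTree a (Fin (b j))) :
    (t.subst u).subst r = t.subst fun i => (u i).subst r := by
  induction t with
  | leaf => rfl
  | node i ts ih => simp only [subst, subst_graft, ih]

theorem map_subst {c : I → ℕ} (e : J → K) (b : K → ℕ) (t : PTree c L)
    (u : ∀ i, PTree (fun j => b (e j)) (Fin (c i))) :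
    (t.subst u).map e b = t.subst fun i => (u i).map e b := by
  induction t with
  | leaf => rfl
  | node i ts ih => simp only [subst, map_graft, ih]

theorem subst_map (e : I → J) (c : J → ℕ) {b : K → ℕ} (t : PTree (fun i => c (e i)) L)
    (u : ∀ j, PTree b (Fin (c j))) :
    (t.map e c).subst u = t.subst fun i => u (e i) := by
  induction t with
  | leaf => rfl
  | node i ts ih => simp only [subst, map, ih]

theorem subst_corolla {c : I → ℕ} (t : PTree c L) : (t.subst fun i => corolla c i) = t := by
  induction t with
  | leaf => rfl
  | node i ts ih =>
    change node i (fun j => (ts j).subst fun i => corolla c i) = _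
    simp only [ih]

theorem corolla_subst {c : I → ℕ} {b : J → ℕ} (i : I) (u : ∀ i, PTree b (Fin (c i))) :
    (corolla c i).subst u = u i := by
  simp only [corolla, subst]
  exact graft_leaf _

theorem leaves_map (e : I → J) (c : J → ℕ) (t : PTree (fun i => c (e i)) L) :
    (t.map e c).leaves = t.leaves := by
  induction t with
  | leaf => rfl
  | node i ts ih => simp only [map, leaves, ih]

theorem vertices_map (e : I → J) (c : J → ℕ) (t : PTree (fun i => c (e i)) L) :
    (t.map e c).vertices = t.vertices.map e := by
  induction t with
  | leaf => rfl
  | node i ts ih => simp only [map, vertices, ih, List.map_cons, List.map_flatMap]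

theorem leaves_graft {c : I → ℕ} (t : PTree c L) (g : L → PTree c M) :
    (t.graft g).leaves = t.leaves.flatMap fun l => (g l).leaves := by
  induction t with
  | leaf => simp [graft, leaves]
  | node i ts ih => simp only [graft, leaves, ih, List.flatMap_assoc]

theorem vertices_graft {c : I → ℕ} (t : PTree c L) (g : L → PTree c M) :
    (t.graft g).vertices.Perm (t.vertices ++ t.leaves.flatMap fun l => (g l).vertices) := by
  induction t with
  | leaf => simp [graft, leaves, vertices]
  | node i ts ih =>
    simp only [graft, leaves, vertices, List.cons_append, List.flatMap_assoc]
    refine List.Perm.cons i ?_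
    refine (List.Perm.flatMap_left _ fun j _ => ih j).trans ?_
    exact (List.flatMap_append_perm _ _ _).symm

/-- The list contains each element exactly once. -/
def _root_.TwArr.IsEnum (l : List L) : Prop := l.Nodup ∧ ∀ x, x ∈ l

theorem _root_.TwArr.IsEnum.perm {l l' : List L} (h : IsEnum l) (h' : IsEnum l') : l.Perm l' :=
  (List.perm_ext_iff_of_nodup h.1 h'.1).2 fun x => ⟨fun _ => h'.2 x, fun _ => h.2 x⟩

theorem _root_.TwArr.IsEnum.of_perm {l l' : List L} (h : IsEnum l) (p : l.Perm l') : IsEnum l' :=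
  ⟨p.nodup_iff.1 h.1, fun x => p.mem_iff.1 (h.2 x)⟩

theorem _root_.TwArr.isEnum_finRange (n : ℕ) : IsEnum (List.finRange n) :=
  ⟨List.nodup_finRange n, List.mem_finRange⟩

theorem leaves_subst_perm {c : I → ℕ} {b : J → ℕ} (t : PTree c L)
    (u : ∀ i, PTree b (Fin (c i))) (hu : ∀ i, IsEnum (u i).leaves) :
    (t.subst u).leaves.Perm t.leaves := by
  induction t with
  | leaf => exact List.Perm.refl _
  | node i ts ih =>
    simp only [subst, leaves, leaves_graft]
    exact (List.Perm.flatMap_left _ fun j _ => ih j).trans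
      (((hu i).perm (isEnum_finRange _)).flatMap_right _)

theorem leaves_subst {c : I → ℕ} {b : J → ℕ} (t : PTree c L)
    (u : ∀ i, PTree b (Fin (c i))) (hu : ∀ i, (u i).leaves = List.finRange (c i)) :
    (t.subst u).leaves = t.leaves := by
  induction t with
  | leaf => rfl
  | node i ts ih => simp only [subst, leaves, leaves_graft, ih, hu]

theorem vertices_subst {c : I → ℕ} {b : J → ℕ} (t : PTree c L)
    (u : ∀ i, PTree b (Fin (c i))) (hu : ∀ i, IsEnum (u i).leaves) :
    (t.subst u).vertices.Perm (t.vertices.flatMap fun i => (u i).vertices) := by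
  induction t with
  | leaf => exact List.Perm.refl _
  | node i ts ih =>
    simp only [subst, vertices, List.flatMap_cons, List.flatMap_assoc]
    refine (vertices_graft _ _).trans (List.Perm.append_left _ ?_)
    exact (List.Perm.flatMap_left _ fun j _ => ih j).trans
      (((hu i).perm (isEnum_finRange _)).flatMap_right _)

theorem isEnum_vertices_comp {J : I → Type} {c : I → ℕ} {b : ∀ i, J i → ℕ} (t : PTree c L)
    (u : ∀ i, PTree (b i) (Fin (c i))) (ht : IsEnum t.vertices)
    (hu : ∀ i, IsEnum (u i).leaves) (hu' : ∀ i, IsEnum (u i).vertices) :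
    IsEnum (t.comp u).vertices := by
  have h : IsEnum (t.vertices.sigma fun i => (u i).vertices) :=
    ⟨ht.1.sigma fun i => (hu' i).1,
      fun x => List.mem_sigma.2 ⟨ht.2 x.1, (hu' x.1).2 x.2⟩⟩
  refine h.of_perm (List.Perm.symm ?_)
  refine (vertices_subst _ _ fun i => ?_).trans ?_
  · rw [leaves_map]
    exact hu i
  · simp only [vertices_map]
    exact List.Perm.refl _

theorem isEnum_vertices_map [Finite I] [Finite J] (e : I ≃ J) (c : J → ℕ)
    (t : PTree (fun i => c (e i)) L) (ht : IsEnum t.vertices) : IsEnum (t.map e c).vertices := by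
  rw [vertices_map]
  exact ⟨ht.1.map e.injective, fun x => List.mem_map.2 ⟨e.symm x, ht.2 _, e.apply_symm_apply x⟩⟩

theorem isEnum_vertices_corolla (n : ℕ) :
    IsEnum (corolla (fun _ : Unit => n) ()).vertices := by
  have h : (corolla (fun _ : Unit => n) ()).vertices = [()] := by
    simp only [corolla, vertices]
    exact congrArg _ (List.flatMap_eq_nil_iff.2 fun _ _ => rfl)
  rw [h]
  exact ⟨List.nodup_singleton _, fun _ => List.mem_singleton.2 rfl⟩

theorem leaves_corolla (c : I → ℕ) (i : I) : (corolla c i).leaves = List.finRange (c i) := by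
  simp [corolla, leaves]

theorem map_comp {J : I → Type} (e : (Σ i, J i) → K) (a : K → ℕ) {c : I → ℕ} (t : PTree c L)
    (u : ∀ i, PTree (fun j => a (e ⟨i, j⟩)) (Fin (c i))) :
    (t.comp u).map e a = t.subst fun i => (u i).map (fun j => e ⟨i, j⟩) a := by
  refine (map_subst e a t fun i => (u i).map (fun j => (⟨i, j⟩ : Σ i, J i))
    (fun x => a (e x))).trans (congrArg t.subst (funext fun i => ?_))
  exact map_map (fun j => (⟨i, j⟩ : Σ i, J i)) e a (u i)

theorem one_comp_eq (c : I → ℕ) {n : ℕ} (t : PTree c (Fin n)) :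
    ((corolla (fun _ : Unit => n) ()).comp (fun _ => t)).map (unitSigma I) c = t := by
  refine (map_comp (unitSigma I) c (corolla (fun _ : Unit => n) ()) (fun _ => t)).trans ?_
  rw [corolla_subst]
  exact map_id c t

theorem comp_one_eq (c : I → ℕ) (t : PTree c L) :
    (t.comp (fun i => corolla (fun _ : Unit => c i) ())).map (sigmaUnit I) c = t :=
  (map_comp (sigmaUnit I) c t (fun i => corolla (fun _ : Unit => c i) ())).trans
    (subst_corolla t)

theorem comp_assoc_eq {J : I → Type} {K : ∀ i, J i → Type} {c : I → ℕ} {b : ∀ i, J i → ℕ}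
    {a : ∀ i j, K i j → ℕ} (t : PTree c L) (u : ∀ i, PTree (b i) (Fin (c i)))
    (r : ∀ i j, PTree (a i j) (Fin (b i j))) :
    ((t.comp u).comp (fun x => r x.1 x.2)).map (Equiv.sigmaAssoc K)
      (fun x : (Σ i, Σ j, K i j) => a x.1 x.2.1 x.2.2) = t.comp fun i => (u i).comp (r i) := by
  refine (map_comp (Equiv.sigmaAssoc K) (fun x : (Σ i, Σ j, K i j) => a x.1 x.2.1 x.2.2)
    (t.comp u) (fun x => r x.1 x.2)).trans ?_
  refine (subst_subst t _ _).trans (congrArg t.subst (funext fun i => ?_))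
  refine (subst_map (fun j => (⟨i, j⟩ : Σ i, J i)) (fun x => b x.1 x.2) (u i) _).trans ?_
  exact (map_comp (fun y : (Σ j, K i j) => (⟨i, y⟩ : Σ i, Σ j, K i j))
    (fun x => a x.1 x.2.1 x.2.2) (u i) (r i)).symm

theorem map_comp_eq (e : I ≃ K) {J : K → Type} {c : K → ℕ} {b : ∀ i, J i → ℕ}
    (t : PTree (fun i => c (e i)) L) (u : ∀ i, PTree (b i) (Fin (c i))) :
    (t.map e c).comp u = (t.comp fun i => u (e i)).map (Equiv.sigmaCongrLeft (β := J) e)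
      (fun x : (Σ i, J i) => b x.1 x.2) :=
  (subst_map e c t _).trans (map_comp (Equiv.sigmaCongrLeft (β := J) e)
    (fun x : (Σ i, J i) => b x.1 x.2) t fun i => u (e i)).symm

theorem comp_map_eq {J J' : I → Type} (e : ∀ i, J i ≃ J' i) {c : I → ℕ} {b : ∀ i, J' i → ℕ}
    (t : PTree c L) (u : ∀ i, PTree (fun j => b i (e i j)) (Fin (c i))) :
    (t.comp fun i => (u i).map (e i) (b i)) =
      (t.comp u).map (Equiv.sigmaCongrRight e) (fun x : (Σ i, J' i) => b x.1 x.2) := by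
  refine Eq.trans (congrArg t.subst (funext fun i => ?_)) (map_comp (Equiv.sigmaCongrRight e)
    (fun x : (Σ i, J' i) => b x.1 x.2) t u).symm
  exact map_map (e i) (fun j => (⟨i, j⟩ : Σ i, J' i)) (fun x => b x.1 x.2) (u i)

end PTree

/-- The operad `sOp`, whose algebras are single-coloured symmetric operads. The colours are
arities. The operations with input colours `c` and with output colour `n` are the planar rooted
trees with `n` leaves endowed with a linear order (bijectively marked by `Fin n`), whose vertices
are bijectively marked by the index set `I`, such that the vertex `i` has `c i` input edges.
Composition is substitution of trees into vertices. -/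
def sOp : Operad.{0, 0} ℕ where
  Op {I _} c n := {t : PTree c (Fin n) // IsEnum t.vertices ∧ IsEnum t.leaves}
  one n := ⟨PTree.corolla (fun _ => n) (), PTree.isEnum_vertices_corolla n, by
    rw [PTree.leaves_corolla]
    exact isEnum_finRange n⟩
  comp t u := ⟨t.1.comp fun i => (u i).1,
    PTree.isEnum_vertices_comp _ _ t.2.1 (fun i => (u i).2.2) fun i => (u i).2.1,
    t.2.2.of_perm (PTree.leaves_subst_perm _ _ fun i => by
      rw [PTree.leaves_map]
      exact (u i).2.2).symm⟩
  relabel e c _ t := ⟨t.1.map e c, PTree.isEnum_vertices_map e c _ t.2.1, by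
    rw [PTree.leaves_map]
    exact t.2.2⟩
  relabel_refl c _ t := Subtype.ext (PTree.map_id c t.1)
  relabel_trans e e' c _ t := Subtype.ext (PTree.map_map e e' c t.1)
  one_comp c _ t := Subtype.ext (PTree.one_comp_eq c t.1)
  comp_one c _ t := Subtype.ext (PTree.comp_one_eq c t.1)
  comp_assoc t u r := Subtype.ext (PTree.comp_assoc_eq t.1 (fun i => (u i).1)
    fun i j => (r i j).1)
  relabel_comp e _ _ _ _ _ t u := Subtype.ext (PTree.map_comp_eq e t.1 fun i => (u i).1)
  comp_relabel e _ _ _ t u := Subtype.ext (PTree.comp_map_eq e t.1 fun i => (u i).1)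

/-- The operad `pOp`, whose algebras are planar operads: the suboperad of `sOp` of trees whose
leaves are marked in planar order. -/
def pOp : Operad.{0, 0} ℕ where
  Op {I _} c n := {t : PTree c (Fin n) // IsEnum t.vertices ∧ t.leaves = List.finRange n}
  one n := ⟨PTree.corolla (fun _ => n) (), PTree.isEnum_vertices_corolla n,
    PTree.leaves_corolla _ _⟩
  comp t u := ⟨t.1.comp fun i => (u i).1,
    PTree.isEnum_vertices_comp _ _ t.2.1
      (fun i => by rw [(u i).2.2]; exact isEnum_finRange _) fun i => (u i).2.1,
    (PTree.leaves_subst _ _ fun i => by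
      rw [PTree.leaves_map]
      exact (u i).2.2).trans t.2.2⟩
  relabel e c _ t := ⟨t.1.map e c, PTree.isEnum_vertices_map e c _ t.2.1, by
    rw [PTree.leaves_map]
    exact t.2.2⟩
  relabel_refl c _ t := Subtype.ext (PTree.map_id c t.1)
  relabel_trans e e' c _ t := Subtype.ext (PTree.map_map e e' c t.1)
  one_comp c _ t := Subtype.ext (PTree.one_comp_eq c t.1)
  comp_one c _ t := Subtype.ext (PTree.comp_one_eq c t.1)
  comp_assoc t u r := Subtype.ext (PTree.comp_assoc_eq t.1 (fun i => (u i).1)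
    fun i j => (r i j).1)
  relabel_comp e _ _ _ _ _ t u := Subtype.ext (PTree.map_comp_eq e t.1 fun i => (u i).1)
  comp_relabel e _ _ _ t u := Subtype.ext (PTree.comp_map_eq e t.1 fun i => (u i).1)

/-- The inclusion of operads `pOp → sOp`. -/
def pOpToSOp : OperadHom pOp sOp where
  app t := ⟨t.1, t.2.1, by
    rw [t.2.2]
    exact isEnum_finRange _⟩
  app_one _ := rfl
  app_comp _ _ := rfl
  app_relabel _ _ _ _ := rfl

/-- Planar (single-coloured) operads: algebras over `pOp`. -/
abbrev PlanarOperad := OpAlgebra.{0, 0, w} pOp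

/-- Symmetric (single-coloured) operads: algebras over `sOp`. -/
abbrev SymmetricOperad := OpAlgebra.{0, 0, w} sOp

/-- The terminal planar operad, with one operation in each arity `n ≥ 0`. -/
def uAsPl : PlanarOperad.{0} := terminalAlgebra pOp

/-- The symmetrization of a planar operad: its extension along the inclusion `pOp → sOp`. -/
noncomputable def Sym (P : PlanarOperad.{w}) : SymmetricOperad.{max 1 w} := P.ext pOpToSOp

/-- The symmetric operad `uAs` of monoids: the symmetrization of the terminal planar operad. -/
noncomputable def uAs : SymmetricOperad.{1} := Sym uAsPl

/-- The functor between twisted arrow categories induced by the inclusion `pOp → sOp` and by the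
canonical map from a planar operad `P` to its symmetrization. -/
noncomputable def twSym (P : PlanarOperad.{w}) : Tw P ⥤ Tw (Sym P) :=
  Tw.map pOpToSOp (P.extUnit pOpToSOp)

end TwArr

namespace TwArr

/-! Symmetrization. An operation of `sOp` is a planar tree followed by a permutation of its leaves
(`permCorolla_planarize`), and substitution of planar trees into vertices does not change the order
of the leaves. The relations in `Adj pOpToSOp S A` come from `pOp` only, so the leaf order and the
planar part of an expression are well defined on classes. Hence planar expressions embed into
symmetric ones (`Adj.planar_ofPlanar`), their image consists of the elements with planar leaf order
(`Adj.ofPlanar_planar`), and every element is a permutation of a planar one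
(`Adj.exists_act_permCorolla`). For `twSym P` this gives faithfulness at once. It is full because
evaluation preserves the leaf order (`SymTO.leafOrder_ev`): a morphism whose target comes from `P`
has planar leaf order, and if its source comes from `P` too, it is a planar expression. It is
essentially surjective because permutations of inputs are isomorphisms in the twisted arrow
category. The simplex category. An element of `EO(uAsPl)` with one variable of arity `m` is a tree
with a distinguished vertex, all other vertices being constants. As `uAsPl` has a single constant in
each arity, the part outside the distinguished vertex and the parts above its inputs contract to one
vertex each (`exists_eq_nf`). What remains is a division of the `n` leaves into consecutive blocks:
one to the left, one above each of the `m` inputs, one to the right. The `m + 1` cuts between the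
blocks lie in the `n + 1` gaps of `Fin n`, and so form a monotone map from `Fin (m + 1)` to `Fin (n
+ 1)`. Distinct maps give distinct elements, and composition is respected, because of an action on
lists: constants concatenate, and the variable concatenates while inserting a letter in gap `i`. The
normal form of `φ` then inserts the letter in gap `φ i` (`markHom_nfOf`). Since `uAsPl` is terminal,
its twisted arrow category has the same morphisms as its enveloping category. The last claim
combines the two halves. -/

theorem IsEnum.length_eq {n : ℕ} {l : List (Fin n)} (h : IsEnum l) : l.length = n := by
  simpa using (h.perm (isEnum_finRange n)).length_eq

/-- The permutation whose list of values is a given enumeration. -/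
def IsEnum.toPerm {n : ℕ} {l : List (Fin n)} (h : IsEnum l) : Equiv.Perm (Fin n) :=
  (finCongr h.length_eq.symm).trans (h.1.getEquivOfForallMemList l h.2)

theorem IsEnum.map_toPerm {n : ℕ} {l : List (Fin n)} (h : IsEnum l) :
    (List.finRange n).map h.toPerm = l := by
  apply List.ext_getElem
  · simp [h.length_eq]
  · intro i h1 h2
    simp [IsEnum.toPerm]

theorem perm_ext_of_map_finRange {n : ℕ} {σ τ : Equiv.Perm (Fin n)}
    (h : (List.finRange n).map σ = (List.finRange n).map τ) : σ = τ :=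
  Equiv.ext fun x => List.map_inj_left.1 h x (List.mem_finRange x)

/-! ### Renumbering of the leaves of trees -/

namespace PTree

variable {I J K L M N : Type}

/-- Change of marks of leaves. -/
def mapLeaves {c : I → ℕ} (g : L → M) (t : PTree c L) : PTree c M :=
  t.graft fun l => leaf (g l)

theorem leaves_mapLeaves {c : I → ℕ} (g : L → M) (t : PTree c L) :
    (t.mapLeaves g).leaves = t.leaves.map g := by
  rw [mapLeaves, leaves_graft]
  exact List.flatMap_pure_eq_map g _

theorem vertices_mapLeaves {c : I → ℕ} (g : L → M) (t : PTree c L) :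
    (t.mapLeaves g).vertices = t.vertices := by
  induction t with
  | leaf => rfl
  | node i ts ih =>
    change vertices (node i fun j => (ts j).mapLeaves g) = _
    simp only [vertices, ih]

theorem mapLeaves_mapLeaves {c : I → ℕ} (g : L → M) (h : M → N) (t : PTree c L) :
    (t.mapLeaves g).mapLeaves h = t.mapLeaves fun l => h (g l) :=
  graft_graft t _ _

theorem mapLeaves_id {c : I → ℕ} (t : PTree c L) : (t.mapLeaves fun l => l) = t :=
  graft_leaf t

theorem map_mapLeaves (e : I → J) (c : J → ℕ) (t : PTree (fun i => c (e i)) L) (g : L → M) :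
    (t.mapLeaves g).map e c = (t.map e c).mapLeaves g :=
  map_graft e c t _

theorem subst_mapLeaves {c : I → ℕ} {b : J → ℕ} (t : PTree c L) (g : L → M)
    (u : ∀ i, PTree b (Fin (c i))) : (t.mapLeaves g).subst u = (t.subst u).mapLeaves g :=
  subst_graft t _ u

end PTree

/-! ### Operations of `sOp` as planar trees with a permutation -/

section planarize

variable {I J : Type} [Finite I] [Finite J] {n : ℕ}

/-- Renumbering of the leaves of a tree in planar order. -/
def planarize {c : I → ℕ} (t : sOp.Op c n) : pOp.Op c n :=
  ⟨t.1.mapLeaves t.2.2.toPerm.symm, by rw [PTree.vertices_mapLeaves]; exact t.2.1, by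
    rw [PTree.leaves_mapLeaves]
    exact (congrArg _ t.2.2.map_toPerm.symm).trans (by simp)⟩

/-- A permutation is determined by its list of values, so any `σ` that produces the leaf order
computes the renumbering, without unfolding `toPerm`. -/
theorem planarize_val {c : I → ℕ} (t : sOp.Op c n) (σ : Equiv.Perm (Fin n))
    (h : t.1.leaves = (List.finRange n).map σ) : (planarize t).1 = t.1.mapLeaves σ.symm := by
  have : t.2.2.toPerm = σ := perm_ext_of_map_finRange (t.2.2.map_toPerm.trans h)
  rw [← this]
  rfl

/-- Planar trees substituted into vertices leave the order of the leaves unchanged, so both sides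
are renumbered by the same permutation. This makes renumbering compatible with the relation `Step
pOpToSOp`. -/
theorem planarize_comp {J : I → Type} [∀ i, Finite (J i)] {c : I → ℕ} {b : ∀ i, J i → ℕ}
    (t : sOp.Op c n) (r : ∀ i, pOp.Op (b i) (c i)) :
    planarize (sOp.comp t fun i => pOpToSOp.app (r i)) = pOp.comp (planarize t) r := by
  refine Subtype.ext ((planarize_val _ t.2.2.toPerm ?_).trans ?_)
  · refine (PTree.leaves_subst _ _ fun i => ?_).trans t.2.2.map_toPerm.symm
    rw [PTree.leaves_map]
    exact (r i).2.2
  · exact (PTree.subst_mapLeaves _ _ _).symm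

theorem planarize_relabel (e : I ≃ J) (c : J → ℕ) (t : sOp.Op (fun i => c (e i)) n) :
    planarize (sOp.relabel e c t) = pOp.relabel e c (planarize t) := by
  refine Subtype.ext ((planarize_val _ t.2.2.toPerm ?_).trans ?_)
  · exact (PTree.leaves_map _ _ _).trans t.2.2.map_toPerm.symm
  · exact (PTree.map_mapLeaves _ _ _ _).symm

theorem planarize_app {c : I → ℕ} (t : pOp.Op c n) : planarize (pOpToSOp.app t) = t :=
  Subtype.ext ((planarize_val _ (Equiv.refl _) (t.2.2.trans (List.map_id _).symm)).trans
    (PTree.mapLeaves_id _))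

theorem app_planarize {c : I → ℕ} (t : sOp.Op c n) (h : t.1.leaves = List.finRange n) :
    pOpToSOp.app (planarize t) = t :=
  Subtype.ext ((planarize_val _ (Equiv.refl _) (h.trans (List.map_id _).symm)).trans
    (PTree.mapLeaves_id _))

/-- The tree with one vertex, whose leaves are permuted by `σ`. -/
def permCorolla (σ : Equiv.Perm (Fin n)) : sOp.Op (fun _ : Unit => n) n :=
  ⟨(PTree.corolla (fun _ : Unit => n) ()).mapLeaves σ, by
    rw [PTree.vertices_mapLeaves]; exact PTree.isEnum_vertices_corolla n, by
    rw [PTree.leaves_mapLeaves, PTree.leaves_corolla]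
    exact ⟨(List.nodup_finRange n).map σ.injective, fun x =>
      List.mem_map.2 ⟨σ.symm x, List.mem_finRange _, σ.apply_symm_apply x⟩⟩⟩

theorem permCorolla_comp {c : I → ℕ} (σ : Equiv.Perm (Fin n)) (t : sOp.Op c n) :
    (sOp.relabel (unitSigma I) c (sOp.comp (permCorolla σ) fun _ => t)).1 = t.1.mapLeaves σ := by
  refine (PTree.map_comp (unitSigma I) c (permCorolla σ).1 fun _ => t.1).trans ?_
  refine (PTree.subst_mapLeaves _ _ _).trans ?_
  rw [PTree.corolla_subst]
  exact congrArg _ (PTree.map_id c t.1)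

theorem permCorolla_one : permCorolla (Equiv.refl (Fin n)) = sOp.one n :=
  Subtype.ext (PTree.mapLeaves_id _)

theorem permCorolla_mul (σ τ : Equiv.Perm (Fin n)) :
    sOp.relabel (unitSigma Unit) (fun _ => n) (sOp.comp (permCorolla σ) fun _ => permCorolla τ) =
      permCorolla (τ.trans σ) :=
  Subtype.ext ((permCorolla_comp σ (permCorolla τ)).trans (PTree.mapLeaves_mapLeaves _ _ _))

/-- The permutation read off from the leaves undoes the renumbering. This is the factorization of an
operation of `sOp` into a planar operation and a permutation. -/
theorem permCorolla_planarize {c : I → ℕ} (t : sOp.Op c n) :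
    sOp.relabel (unitSigma I) c (sOp.comp (permCorolla t.2.2.toPerm)
      fun _ => pOpToSOp.app (planarize t)) = t := by
  refine Subtype.ext ((permCorolla_comp _ _).trans ((PTree.mapLeaves_mapLeaves _ _ _).trans ?_))
  simp only [Equiv.apply_symm_apply]
  exact PTree.mapLeaves_id _

theorem act_permCorolla_trans (B : SymmetricOperad.{w}) (σ τ : Equiv.Perm (Fin n))
    (x : B.carrier n) : B.act (permCorolla σ) (fun _ => B.act (permCorolla τ) fun _ => x) =
      B.act (permCorolla (τ.trans σ)) fun _ => x := by
  rw [← permCorolla_mul, B.act_relabel]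
  exact (B.act_comp (permCorolla σ) (fun _ => permCorolla τ) fun _ => x).symm

/-- Used both in `Sym P` and in `TO B`, where it makes permutations invertible in the twisted arrow
category. -/
theorem act_permCorolla_symm (B : SymmetricOperad.{w}) (σ : Equiv.Perm (Fin n))
    (x : B.carrier n) :
    B.act (permCorolla σ.symm) (fun _ => B.act (permCorolla σ) fun _ => x) = x := by
  rw [act_permCorolla_trans, Equiv.self_trans_symm, permCorolla_one]
  exact B.act_one n fun _ => x

end planarize

namespace Adj

/-! ### The symmetric operad generated by variables and by a planar operad -/

variable {S : ℕ → Type s} {A : PlanarOperad.{w}} {n : ℕ}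

/-- The order of the leaves, an invariant of expressions. -/
def leafOrder (x : (Adj pOpToSOp S A).carrier n) : List (Fin n) :=
  Quot.lift (fun E : Expr sOp S A.carrier n => E.op.1.leaves) (by
    intro E E' h
    cases h with
    | mk e c b q r x z h =>
      -- The substituted operations `r i` belong to `pOp`. For relations coming from `sOp` the leaf
      -- order would not be invariant.
      refine (Eq.trans (PTree.leaves_map _ _ _) (PTree.leaves_subst _ _ fun i => ?_)).symm
      rw [PTree.leaves_map]
      exact (r i).2.2) x

/-- Renumbering of the leaves in planar order. -/
def planar (x : (Adj pOpToSOp S A).carrier n) : (Adj (OperadHom.id pOp) S A).carrier n :=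
  Quot.map (fun E : Expr sOp S A.carrier n => ⟨E.I, E.fin, E.col, planarize E.op, E.arg⟩) (by
    intro E E' h
    cases h with
    | mk e c b q r x z h =>
      have := Step.mk (f := OperadHom.id pOp) e c b (planarize q) r x z h
      have h1 : pOp.relabel e b (pOp.comp (planarize q) fun i => (OperadHom.id pOp).app (r i)) =
          planarize (sOp.relabel e b (sOp.comp q fun i => pOpToSOp.app (r i))) := by
        rw [planarize_relabel, planarize_comp]
        rfl
      rwa [h1] at this) x

variable (S A) in
/-- Planar expressions as expressions. -/
noncomputable def ofPlanar :
    OpAlgHom (Adj (OperadHom.id pOp) S A) ((Adj pOpToSOp S A).res pOpToSOp) :=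
  lift (fun _ t => var pOpToSOp A t) (const pOpToSOp S A)

/-- Computes on representatives a morphism defined by a universal property, so that it can be
compared with `planar`, which is defined on representatives and is not a morphism of `sOp`-algebras.
-/
theorem ofPlanar_mk (E : Expr pOp S A.carrier n) : (ofPlanar S A).app (Quot.mk _ E) =
    Quot.mk _ (⟨E.I, E.fin, E.col, pOpToSOp.app E.op, E.arg⟩ : Expr sOp S A.carrier n) := by
  rw [mk_eq_act, mk_eq_act, OpAlgHom.app_act]
  refine congrArg ((Adj pOpToSOp S A).act (pOpToSOp.app E.op)) (funext fun i => ?_)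
  refine (lift_gen (B := (Adj pOpToSOp S A).res pOpToSOp) _ _ (E.arg i)).trans ?_
  dsimp only
  rcases E.arg i with t | a <;> rfl

/-- In particular no new relations between planar expressions appear when permutations are allowed.
Faithfulness of `twSym` rests on this. -/
theorem planar_ofPlanar (x : (Adj (OperadHom.id pOp) S A).carrier n) :
    planar ((ofPlanar S A).app x) = x := by
  induction x using Quot.ind with
  | mk E =>
    rw [ofPlanar_mk]
    change Quot.mk _ _ = _
    dsimp only
    rw [planarize_app]

theorem ofPlanar_planar (x : (Adj pOpToSOp S A).carrier n)
    (h : leafOrder x = List.finRange n) : (ofPlanar S A).app (planar x) = x := by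
  induction x using Quot.ind with
  | mk E =>
    refine (ofPlanar_mk _).trans ?_
    dsimp only
    rw [app_planarize E.op h]

/-- The operation of a representative is factored by `permCorolla_planarize`, and the planar factor
represents `planar x`. -/
theorem exists_act_permCorolla (x : (Adj pOpToSOp S A).carrier n) :
    ∃ σ, x = (Adj pOpToSOp S A).act (permCorolla σ) fun _ => (ofPlanar S A).app (planar x) := by
  induction x using Quot.ind with
  | mk E =>
    refine ⟨E.op.2.2.toPerm, ?_⟩
    have h : (ofPlanar S A).app (planar (Quot.mk _ E)) = _ := ofPlanar_mk _
    dsimp only at h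
    rw [h, mk_eq_act, mk_eq_act]
    dsimp only
    conv_lhs => rw [← permCorolla_planarize E.op]
    refine ((Adj pOpToSOp S A).act_relabel (unitSigma E.I) E.col _ _).trans ?_
    exact (Adj pOpToSOp S A).act_comp (permCorolla E.op.2.2.toPerm)
      (fun _ => pOpToSOp.app (planarize E.op)) _

end Adj

/-! ### The equivalence of twisted arrow categories -/

section Sym

/-- An algebra generated by itself and by no variables is itself. -/
theorem const_lift_empty {C : Type u} {Q : Operad.{u, v} C} (A : OpAlgebra.{u, v, w} Q) {c : C}
    (x : (Adj (OperadHom.id Q) (fun _ => PEmpty.{1}) A).carrier c) :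
    (Adj.const (OperadHom.id Q) (fun _ => PEmpty.{1}) A).app
      ((Adj.lift (fun _ => PEmpty.elim) (OpAlgHom.id A) :
        OpAlgHom (Adj (OperadHom.id Q) (fun _ => PEmpty.{1}) A) A).app x) = x :=
  Adj.hom_congr (((Adj.lift (fun _ => PEmpty.elim) (OpAlgHom.id A) :
      OpAlgHom (Adj (OperadHom.id Q) (fun _ => PEmpty.{1}) A) A)).comp
    (Adj.const (OperadHom.id Q) (fun _ => PEmpty.{1}) A)) (OpAlgHom.id _) x
    (fun a => congrArg (Adj.const (OperadHom.id Q) (fun _ => PEmpty.{1}) A).app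
      (Adj.lift_const (B := A) (f := OperadHom.id Q) _ (OpAlgHom.id A) a))
    (fun t _ => t.2.elim)

variable {P : PlanarOperad.{w}} {n : ℕ}

/-- The planar operation that underlies an operation of the symmetrization. -/
noncomputable def Sym.planar (x : (Sym P).carrier n) : P.carrier n :=
  (Adj.lift (fun _ => PEmpty.elim) (OpAlgHom.id P) :
    OpAlgHom (Adj (OperadHom.id pOp) (fun _ => PEmpty.{1}) P) P).app (Adj.planar x)

theorem ofPlanar_const (S : ℕ → Type s) (a : P.carrier n) :
    (Adj.ofPlanar S P).app ((Adj.const (OperadHom.id pOp) S P).app a) =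
      (Adj.const pOpToSOp S P).app a :=
  Adj.lift_const (B := (Adj pOpToSOp S P).res pOpToSOp) _ _ a

theorem ofPlanar_var {S : ℕ → Type s} (t : S n) :
    (Adj.ofPlanar S P).app (Adj.var (OperadHom.id pOp) P t) = Adj.var pOpToSOp P t :=
  Adj.lift_var (B := (Adj pOpToSOp S P).res pOpToSOp) _ _ t

/-- The image of the unit consists of planar expressions, where `Adj.planar` inverts `Adj.ofPlanar`.
It follows that `P` embeds into its symmetrization. -/
theorem Sym.planar_extUnit (a : P.carrier n) :
    Sym.planar ((P.extUnit pOpToSOp).app a) = a := by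
  have h : Adj.planar ((Adj.const pOpToSOp (fun _ => PEmpty.{1}) P).app a) =
      (Adj.const (OperadHom.id pOp) (fun _ => PEmpty.{1}) P).app a :=
    (congrArg Adj.planar (ofPlanar_const _ a).symm).trans (Adj.planar_ofPlanar _)
  exact (congrArg _ h).trans (Adj.lift_const (B := P) (f := OperadHom.id pOp) _ _ a)

theorem leafOrder_extUnit (a : P.carrier n) :
    Adj.leafOrder ((P.extUnit pOpToSOp).app a) = List.finRange n :=
  PTree.leaves_corolla _ _

/-- An operation of the symmetrization is obtained from its underlying planar operation by a
permutation of its inputs. -/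
theorem Sym.exists_act_permCorolla (x : (Sym P).carrier n) :
    ∃ σ, x = (Sym P).act (permCorolla σ) fun _ => (P.extUnit pOpToSOp).app (Sym.planar x) := by
  obtain ⟨σ, h⟩ := Adj.exists_act_permCorolla x
  refine ⟨σ, h.trans (congrArg _ (funext fun _ => ?_))⟩
  rw [← const_lift_empty P (Adj.planar x), ofPlanar_const]
  rfl

/-- The symmetric operad generated by `P` and by variables from `P`. -/
noncomputable abbrev SymTO (P : PlanarOperad.{w}) : SymmetricOperad.{max 1 w} :=
  Adj pOpToSOp P.carrier P

/-- The morphism from the symmetrization of `P` to `SymTO P` given by the second copy of `P`. -/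
noncomputable def SymTO.ofSym (P : PlanarOperad.{w}) : OpAlgHom (Sym P) (SymTO P) :=
  Adj.lift (fun _ => PEmpty.elim) (Adj.const pOpToSOp P.carrier P)

theorem SymTO.ofSym_extUnit (a : P.carrier n) :
    (SymTO.ofSym P).app ((P.extUnit pOpToSOp).app a) = (Adj.const pOpToSOp P.carrier P).app a :=
  Adj.lift_const _ _ a

/-- The morphism that replaces variables by their underlying planar operations. -/
noncomputable def SymTO.ofTO (P : PlanarOperad.{w}) : OpAlgHom (TO (Sym P)) (SymTO P) :=
  Adj.lift (fun _ t => Adj.var pOpToSOp P (Sym.planar t)) (SymTO.ofSym P)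

theorem SymTO.ofTO_var (t : (Sym P).carrier n) :
    (SymTO.ofTO P).app (Adj.var (OperadHom.id sOp) (Sym P) t) =
      Adj.var pOpToSOp P (Sym.planar t) :=
  Adj.lift_var (f := OperadHom.id sOp) (B := SymTO P) _ (SymTO.ofSym P) t

theorem SymTO.ofTO_const (a : (Sym P).carrier n) :
    (SymTO.ofTO P).app ((Adj.const (OperadHom.id sOp) (Sym P).carrier (Sym P)).app a) =
      (SymTO.ofSym P).app a :=
  Adj.lift_const (f := OperadHom.id sOp) (B := SymTO P) _ (SymTO.ofSym P) a

/-- The morphism that includes `P` into its symmetrization. -/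
noncomputable def SymTO.toTO (P : PlanarOperad.{w}) : OpAlgHom (SymTO P) (TO (Sym P)) :=
  Adj.lift (fun _ t => Adj.var (OperadHom.id sOp) (Sym P) ((P.extUnit pOpToSOp).app t))
    ((P.extUnit pOpToSOp).comp
      ((Adj.const (OperadHom.id sOp) (Sym P).carrier (Sym P)).res pOpToSOp))

theorem SymTO.toTO_var (t : P.carrier n) : (SymTO.toTO P).app (Adj.var pOpToSOp P t) =
    Adj.var (OperadHom.id sOp) (Sym P) ((P.extUnit pOpToSOp).app t) :=
  Adj.lift_var (B := TO (Sym P)) _ _ t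

theorem SymTO.toTO_const (a : P.carrier n) :
    (SymTO.toTO P).app ((Adj.const pOpToSOp P.carrier P).app a) =
      (Adj.const (OperadHom.id sOp) (Sym P).carrier (Sym P)).app ((P.extUnit pOpToSOp).app a) :=
  Adj.lift_const (B := TO (Sym P)) _ _ a

/-- The functor of twisted arrow categories on planar expressions. -/
noncomputable abbrev symMap (P : PlanarOperad.{w}) : OpAlgHom (TO P) ((TO (Sym P)).res pOpToSOp) :=
  TO.map pOpToSOp (P.extUnit pOpToSOp)

/-- Elements of `TO (Sym P)` are expressions in classes of expressions. `SymTO P` is a single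
quotient of expressions in `P`, on which `planar` is available; this comparison transfers its left
inverse property to `symMap`. -/
theorem SymTO.ofTO_symMap (x : (TO P).carrier n) :
    (SymTO.ofTO P).app ((symMap P).app x) = (Adj.ofPlanar P.carrier P).app x := by
  refine Adj.hom_congr ((symMap P).comp ((SymTO.ofTO P).res pOpToSOp))
    (Adj.ofPlanar P.carrier P) x (fun a => ?_) fun t _ => ?_
  · refine (congrArg (SymTO.ofTO P).app (TO.map_const _ _ a)).trans ?_
    exact (SymTO.ofTO_const _).trans ((SymTO.ofSym_extUnit a).trans (ofPlanar_const _ a).symm)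
  · refine (congrArg (SymTO.ofTO P).app (TO.map_var _ _ t.2)).trans ?_
    refine (SymTO.ofTO_var _).trans (Eq.trans ?_ (ofPlanar_var t.2).symm)
    exact congrArg (Adj.var pOpToSOp P) (Sym.planar_extUnit t.2)

theorem SymTO.toTO_ofPlanar (x : (TO P).carrier n) :
    (SymTO.toTO P).app ((Adj.ofPlanar P.carrier P).app x) = (symMap P).app x := by
  refine Adj.hom_congr ((Adj.ofPlanar P.carrier P).comp ((SymTO.toTO P).res pOpToSOp))
    (symMap P) x (fun a => ?_) fun t _ => ?_
  · refine (congrArg (SymTO.toTO P).app (ofPlanar_const _ a)).trans ?_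
    exact (SymTO.toTO_const a).trans (TO.map_const pOpToSOp _ a).symm
  · refine (congrArg (SymTO.toTO P).app (ofPlanar_var t.2)).trans ?_
    exact (SymTO.toTO_var t.2).trans (TO.map_var pOpToSOp _ t.2).symm

theorem SymTO.toTO_ofSym (x : (Sym P).carrier n) : (SymTO.toTO P).app ((SymTO.ofSym P).app x) =
    (Adj.const (OperadHom.id sOp) (Sym P).carrier (Sym P)).app x := by
  refine Adj.hom_congr ((SymTO.ofSym P).comp (SymTO.toTO P))
    (Adj.const (OperadHom.id sOp) (Sym P).carrier (Sym P)) x (fun a => ?_) fun t _ => t.2.elim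
  exact (congrArg (SymTO.toTO P).app (SymTO.ofSym_extUnit a)).trans (SymTO.toTO_const a)

/-- `ofTO` forgets the permutation carried by a variable, so it can be undone only when the
variables come from `P`. Constants lose nothing. -/
theorem SymTO.toTO_ofTO (x : (TO (Sym P)).carrier n)
    (hx : ∀ t ∈ Adj.vars x, (P.extUnit pOpToSOp).app (Sym.planar t.2) = t.2) :
    (SymTO.toTO P).app ((SymTO.ofTO P).app x) = x := by
  refine Adj.hom_congr ((SymTO.ofTO P).comp (SymTO.toTO P)) (OpAlgHom.id _) x (fun a => ?_)
    fun t ht => ?_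
  · exact (congrArg (SymTO.toTO P).app (SymTO.ofTO_const a)).trans (SymTO.toTO_ofSym a)
  · refine (congrArg (SymTO.toTO P).app (SymTO.ofTO_var t.2)).trans ?_
    rw [SymTO.toTO_var, hx t ht]
    rfl

/-- Evaluation turns the variables of a representative into constants and keeps its operation, hence
its leaves. This is the key to fullness. -/
theorem SymTO.leafOrder_ev (x : (SymTO P).carrier n) :
    Adj.leafOrder ((ev (Sym P)).app ((SymTO.toTO P).app x)) = Adj.leafOrder x := by
  induction x using Quot.ind with
  | mk E =>
    have h : (ev (Sym P)).app ((SymTO.toTO P).app (Quot.mk _ E)) =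
        (Quot.mk _ (⟨E.I, E.fin, E.col, E.op,
            fun i => Sum.inr (Sum.elim _root_.id _root_.id (E.arg i))⟩ :
          Expr sOp (fun _ => PEmpty.{1}) P.carrier n) :
            AdjCarrier pOpToSOp (fun _ => PEmpty.{1}) P n) := by
      rw [Adj.mk_eq_act, OpAlgHom.app_act, OpAlgHom.app_act]
      refine Eq.trans ?_ (Adj.mk_eq_act _).symm
      refine congrArg ((Sym P).act E.op) (funext fun i => ?_)
      dsimp only
      rcases E.arg i with t | a
      · exact (congrArg (ev (Sym P)).app (SymTO.toTO_var t)).trans (ev_var _ _)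
      · exact (congrArg (ev (Sym P)).app (SymTO.toTO_const a)).trans (ev_const _ _)
    rw [h]
    rfl

theorem symMap_injective : Function.Injective ((symMap P).app (c := n)) := by
  intro x y h
  rw [← Adj.planar_ofPlanar x, ← Adj.planar_ofPlanar y, ← SymTO.ofTO_symMap x,
    ← SymTO.ofTO_symMap y, h]

theorem extUnit_injective : Function.Injective ((P.extUnit pOpToSOp).app (c := n)) :=
  Function.LeftInverse.injective Sym.planar_extUnit

/-- Unlike `TO.vars_map`, this holds for any multiset of variables. Fullness needs this, because the
variables of the preimage are not known beforehand. -/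
theorem TO.vars_symMap (x : (TO P).carrier n) :
    Adj.vars (f := OperadHom.id sOp) (A := Sym P) ((symMap P).app x) = (Adj.vars x).map
      (fun t => (⟨t.1, (P.extUnit pOpToSOp).app t.2⟩ : Σ c, (Sym P).carrier c)) := by
  rw [← Multiset.bind_singleton]
  refine Adj.vars_hom pOpToSOp (symMap P) (fun t : (Σ c, P.carrier c) =>
    {(⟨t.1, (P.extUnit pOpToSOp).app t.2⟩ : Σ c, (Sym P).carrier c)}) x (fun a => ?_) fun t _ => ?_
  · exact (congrArg _ (TO.map_const pOpToSOp _ a)).trans (Adj.vars_const _)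
  · exact (congrArg _ (TO.map_var pOpToSOp _ t.2)).trans (Adj.vars_var _)

instance twSym_faithful : (twSym P).Faithful where
  map_injective h := Subtype.ext (symMap_injective (congrArg Subtype.val h))

instance twSym_full : (twSym P).Full where
  map_surjective {a b} := by
    rintro ⟨x, hx, hev⟩
    have h1 : (SymTO.toTO P).app ((SymTO.ofTO P).app x) = x := by
      refine SymTO.toTO_ofTO x fun t ht => ?_
      rw [hx] at ht
      obtain rfl := Multiset.mem_singleton.1 ht
      exact congrArg _ (Sym.planar_extUnit a.2)
    -- The value of `x` lies in the image of `P`, so its leaves are in planar order, and evaluation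
    -- has not changed that order.
    have h2 : Adj.leafOrder ((SymTO.ofTO P).app x) = List.finRange b.1 := by
      rw [← SymTO.leafOrder_ev, h1, hev]
      exact leafOrder_extUnit b.2
    have h3 : (symMap P).app (Adj.planar ((SymTO.ofTO P).app x)) = x := by
      rw [← SymTO.toTO_ofPlanar, Adj.ofPlanar_planar _ h2, h1]
    refine ⟨⟨Adj.planar ((SymTO.ofTO P).app x), ?_, ?_⟩, Subtype.ext h3⟩
    · have h4 := TO.vars_symMap (Adj.planar ((SymTO.ofTO P).app x))
      rw [h3, hx] at h4
      -- The unit is injective, so the multiset of variables of the preimage can be read off from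
      -- that of `x`.
      refine Multiset.map_injective ?_ (h4.symm.trans (Multiset.map_singleton _ a).symm)
      rintro ⟨m, s⟩ ⟨m', s'⟩ h
      obtain ⟨h1, h2⟩ := Sigma.mk.inj_iff.1 h
      dsimp only at h1 h2
      subst h1
      exact congrArg _ (extUnit_injective (eq_of_heq h2))
    · refine extUnit_injective ?_
      exact (TO.ev_map pOpToSOp _ _).symm.trans ((congrArg _ h3).trans hev)

/-- An element of an algebra, as an object of its twisted arrow category. -/
def Tw.mk {C : Type u} {Q : Operad.{u, v} C} {A : OpAlgebra.{u, v, w} Q} {c : C}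
    (a : A.carrier c) : Tw A :=
  ⟨c, a⟩

/-- A permutation of inputs, as a morphism of the twisted arrow category. -/
noncomputable def Tw.permHom {B : SymmetricOperad.{w}} (σ : Equiv.Perm (Fin n))
    (x y : B.carrier n) (h : B.act (permCorolla σ) (fun _ => x) = y) :
    (Tw.mk x) ⟶ (Tw.mk y) :=
  ⟨(TO B).act (permCorolla σ) fun _ => Adj.var _ B x, by
    rw [Adj.vars, OpAlgHom.app_act]
    refine (finsum_unique _).trans ?_
    exact Adj.vars_var _, by
    rw [OpAlgHom.app_act]
    exact (congrArg _ (funext fun _ => ev_var B x)).trans h⟩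

theorem Tw.permHom_comp {B : SymmetricOperad.{w}} (σ : Equiv.Perm (Fin n)) {x y : B.carrier n}
    (h : B.act (permCorolla σ) (fun _ => x) = y)
    (h' : B.act (permCorolla σ.symm) (fun _ => y) = x) :
    Tw.permHom σ x y h ≫ Tw.permHom σ.symm y x h' = 𝟙 (Tw.mk x) := by
  refine Subtype.ext ?_
  change (Adj.subst ⟨n, y⟩ _).app ((TO B).act _ _) = _
  rw [OpAlgHom.app_act]
  refine (congrArg _ (funext fun _ => Adj.subst_var_self _ _)).trans ?_
  exact act_permCorolla_symm (TO B) σ _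

/-- An operation of `Sym P` is a permutation of its underlying planar operation, and that
permutation is an isomorphism between the two objects. -/
instance twSym_essSurj : (twSym P).EssSurj where
  mem_essImage := by
    rintro ⟨n, y⟩
    obtain ⟨σ, h⟩ := Sym.exists_act_permCorolla y
    have h' : (Sym P).act (permCorolla σ.symm) (fun _ => y) =
        (P.extUnit pOpToSOp).app (Sym.planar y) := by
      exact (congrArg _ (funext fun _ => h)).trans (act_permCorolla_symm (Sym P) σ _)
    exact ⟨⟨n, Sym.planar y⟩, ⟨⟨Tw.permHom σ _ _ h.symm, Tw.permHom σ.symm _ _ h',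
      Tw.permHom_comp σ h.symm h', Tw.permHom_comp σ.symm h' h.symm⟩⟩⟩

/-- The twisted arrow categories of a planar operad and of its symmetrization are equivalent. -/
theorem twSym_isEquivalence (P : PlanarOperad.{w}) : (twSym P).IsEquivalence where

end Sym

/-! ### Decompositions of trees -/

/-- The inductive step for lifting marks of trees: a lift of a concatenation over the inputs of a
vertex is cut into lifts for the subtrees. Absence of repetitions in `L` allows the pieces to be
indexed by elements instead of positions. -/
theorem exists_flatMap_eq_of_map {α β γ : Type*} (g : β → γ) (F : α → List γ) (L : List α)
    (hL : L.Nodup) (l : List β) (h : L.flatMap F = l.map g) :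
    ∃ H : α → List β, L.flatMap H = l ∧ ∀ a ∈ L, F a = (H a).map g := by
  classical
  induction L generalizing l with
  | nil => exact ⟨fun _ => [], by simpa using h, by simp⟩
  | cons a L ih =>
    rw [List.flatMap_cons] at h
    obtain ⟨l₁, l₂, rfl, h₁, h₂⟩ := List.map_eq_append_iff.1 h.symm
    obtain ⟨H, rfl, hH⟩ := ih (List.nodup_cons.1 hL).2 l₂ h₂.symm
    have ha : ∀ x ∈ L, x ≠ a := fun x hx hxa => (List.nodup_cons.1 hL).1 (hxa ▸ hx)
    refine ⟨Function.update H a l₁, ?_, ?_⟩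
    · rw [List.flatMap_cons, Function.update_self]
      refine congrArg _ (List.flatMap_congr fun x hx => ?_)
      rw [Function.update_of_ne (ha x hx)]
    · intro x hx
      rcases List.mem_cons.1 hx with rfl | hx
      · rw [Function.update_self, h₁]
      · rw [Function.update_of_ne (ha x hx), hH x hx]

theorem flatMap_finRange_get {α β : Type*} (l : List α) (F : α → List β) :
    ((List.finRange l.length).flatMap fun s => F (l.get s)) = l.flatMap F := by
  conv_rhs => rw [← List.map_get_finRange l]
  rw [List.flatMap_map]

theorem IsEnum.bijective {α β : Type} {l : List α} {e : α → β} (h : IsEnum l)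
    (h' : IsEnum (l.map e)) : Function.Bijective e :=
  ⟨fun _ _ hxy => List.inj_on_of_nodup_map h'.1 (h.2 _) (h.2 _) hxy, fun y => by
    obtain ⟨x, -, hx⟩ := List.mem_map.1 (h'.2 y)
    exact ⟨x, hx⟩⟩

namespace PTree

variable {I J K L M N : Type}

/-- With `g` the `get` of the list of leaves and `l = List.finRange _`, this numbers the leaves of
an arbitrary tree in planar order, as operations of `pOp` require. -/
theorem exists_mapLeaves_eq {c : I → ℕ} (g : K → L) (t : PTree c L) (l : List K)
    (h : t.leaves = l.map g) : ∃ r : PTree c K, r.leaves = l ∧ r.mapLeaves g = t := by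
  induction t generalizing l with
  | leaf x =>
    obtain ⟨k, rfl, hk⟩ := List.map_eq_singleton_iff.1 h.symm
    exact ⟨leaf k, rfl, congrArg leaf hk⟩
  | node i ts ih =>
    obtain ⟨H, rfl, hH⟩ := exists_flatMap_eq_of_map g _ _ (List.nodup_finRange _) l h
    choose r hr hr' using fun j => ih j (H j) (hH j (List.mem_finRange j))
    refine ⟨node i r, ?_, ?_⟩
    · simp only [leaves, hr]
    · change node i (fun j => (r j).mapLeaves g) = _
      simp only [hr']

/-- Likewise for vertices: a subtree, whose vertices are only some of the marks, becomes a tree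
whose vertices are enumerated by its own index set. -/
theorem exists_map_eq {b : I → ℕ} (g : K → I) (t : PTree b L) (l : List K)
    (h : t.vertices = l.map g) :
    ∃ r : PTree (fun k => b (g k)) L, r.vertices = l ∧ r.map g b = t := by
  induction t generalizing l with
  | leaf x => exact ⟨leaf x, (List.map_eq_nil_iff.1 h.symm).symm, rfl⟩
  | node i ts ih =>
    obtain ⟨k, l, rfl, rfl, h⟩ := List.map_eq_cons_iff.1 h.symm
    obtain ⟨H, rfl, hH⟩ := exists_flatMap_eq_of_map g _ _ (List.nodup_finRange _) l h.symm
    choose r hr hr' using fun j => ih j (H j) (hH j (List.mem_finRange j))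
    exact ⟨node k r, by simp only [vertices, hr], by simp only [map, hr']⟩

/-- A tree with a distinguished vertex consists of the part outside of this vertex, in which the
leaf `none` replaces this vertex, and of the parts above the inputs of this vertex. -/
theorem exists_graft_eq {c : I → ℕ} (t : PTree c L) (i : I) (hi : i ∈ t.vertices) :
    ∃ (o : PTree c (Option L)) (up : Fin (c i) → PTree c L) (pre post : List L),
      o.leaves = pre.map some ++ none :: post.map some ∧
      t = o.graft fun x => x.elim (node i up) leaf := by
  classical
  induction t with
  | leaf => simp [vertices] at hi
  | node k ts ih =>
    rcases List.mem_cons.1 hi with rfl | hi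
    · exact ⟨leaf none, ts, [], [], rfl, rfl⟩
    · obtain ⟨j, -, hj⟩ := List.mem_flatMap.1 hi
      obtain ⟨o, up, pre, post, ho, ht⟩ := ih j hj
      obtain ⟨l₁, l₂, hl⟩ := List.append_of_mem (List.mem_finRange j)
      have hnd := List.nodup_finRange (c k)
      rw [hl, List.nodup_append, List.nodup_cons] at hnd
      -- The subtree that contains the vertex is replaced by its outer part; the leaves of its
      -- siblings are only marked by `some`, and extend `pre` or `post` according to their side.
      set f := Function.update (fun j' => (ts j').mapLeaves some) j o with hf
      have hf' : ∀ j', j' ≠ j → (f j').leaves = (ts j').leaves.map some := fun j' hj' => by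
        rw [hf, Function.update_of_ne hj', leaves_mapLeaves]
      refine ⟨node k f, up, l₁.flatMap (fun j' => (ts j').leaves) ++ pre,
        post ++ l₂.flatMap (fun j' => (ts j').leaves), ?_, ?_⟩
      · have h₁ : l₁.flatMap (fun j' => (f j').leaves) =
            (l₁.flatMap fun j' => (ts j').leaves).map some := by
          rw [List.map_flatMap]
          exact List.flatMap_congr fun x hx => hf' x fun e =>
            hnd.2.2 x hx j (List.mem_cons_self ..) e
        have h₂ : l₂.flatMap (fun j' => (f j').leaves) =
            (l₂.flatMap fun j' => (ts j').leaves).map some := by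
          rw [List.map_flatMap]
          exact List.flatMap_congr fun x hx => hf' x fun e => hnd.2.1.1 (e ▸ hx)
        have h₃ : (f j).leaves = _ := (by rw [hf, Function.update_self] : (f j).leaves = _).trans ho
        rw [leaves, hl, List.flatMap_append, List.flatMap_cons, h₁, h₂, h₃]
        simp
      · refine congrArg (node k) (funext fun j' => ?_)
        by_cases hj' : j' = j
        · subst hj'
          rw [hf, Function.update_self]
          exact ht
        · rw [hf, Function.update_of_ne hj', mapLeaves, graft_graft]
          exact (graft_leaf _).symm

end PTree

/-! ### The contracted trees with a distinguished vertex -/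

section normalForm

open PTree

variable {L : Type} {m : ℕ} (pre : List L) (l : Fin m → List L) (post : List L)

/-- The marks of the inputs of the root vertex of `nfTree`. -/
def nfLeaves : List (Option L) := pre.map some ++ none :: post.map some

/-- The arities of the vertices of `nfTree`. -/
def nfArity : Option (Option (Fin m)) → ℕ
  | none => (nfLeaves pre post).length
  | some none => m
  | some (some j) => (l j).length

/-- The tree with a root vertex, whose inputs are the leaves `pre`, the vertex `some none`, and
the leaves `post`. Above the input `j` of `some none` there is a vertex whose inputs are the
leaves `l j`. -/
def nfTree : PTree (nfArity pre l post) L :=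
  node none fun s : Fin (nfLeaves pre post).length => ((nfLeaves pre post).get s).elim
    (node (some none) fun j : Fin m => node (some (some j)) fun k : Fin (l j).length =>
      leaf ((l j).get k)) leaf

theorem leaves_nfTree :
    (nfTree pre l post).leaves = pre ++ (List.finRange m).flatMap l ++ post := by
  refine (flatMap_finRange_get (nfLeaves pre post) fun x => leaves (x.elim _ leaf)).trans ?_
  simp only [nfLeaves, List.flatMap_append, List.flatMap_cons, List.flatMap_map, Option.elim,
    leaves, List.append_assoc]
  congr 1
  · simp
  · congr 1
    · refine List.flatMap_congr fun j _ => ?_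
      refine (flatMap_finRange_get (l j) fun x => [x]).trans ?_
      simp
    · simp

theorem vertices_nfTree : (nfTree pre l post).vertices =
    none :: some none :: (List.finRange m).map fun j => some (some j) := by
  refine congrArg (List.cons none) ?_
  refine (flatMap_finRange_get (nfLeaves pre post) fun x => vertices (x.elim _ leaf)).trans ?_
  simp only [nfLeaves, List.flatMap_append, List.flatMap_cons, List.flatMap_map, Option.elim,
    vertices]
  have h : ∀ {α : Type} (k : List α),
      (k.flatMap fun _ => ([] : List (Option (Option (Fin m))))) = [] :=
    fun k => List.flatMap_eq_nil_iff.2 fun _ _ => rfl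
  simp only [h, List.nil_append, List.append_nil]
  exact congrArg _ (List.flatMap_pure_eq_map _ _)

theorem isEnum_vertices_nfTree : IsEnum (nfTree pre l post).vertices := by
  rw [vertices_nfTree]
  refine ⟨?_, ?_⟩
  · simp only [List.nodup_cons, List.mem_cons, List.mem_map]
    refine ⟨by simp, by simp, (List.nodup_finRange m).map fun x y h => by simpa using h⟩
  · rintro (_ | _ | j) <;> simp

/-- The substitution of trees into `nfTree`. -/
theorem nfTree_subst {K : Type} {b : K → ℕ} (R : ∀ i, PTree b (Fin (nfArity pre l post i)))
    (o : PTree b (Option L)) (i : K) (up : Fin (b i) → PTree b L) (hm : m = b i)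
    (h₁ : PTree.mapLeaves (nfLeaves pre post).get (R none) = o)
    (h₂ : ∀ g : Fin m → PTree b L,
      PTree.graft (R (some none)) g = node i fun j => g (j.cast hm.symm))
    (h₃ : ∀ j : Fin m, PTree.mapLeaves (l j).get (R (some (some j))) = up (j.cast hm)) :
    (nfTree pre l post).subst R = o.graft fun x => x.elim (node i up) leaf := by
  subst hm
  rw [← h₁]
  refine Eq.trans ?_ (graft_graft _ _ _).symm
  refine congrArg (PTree.graft (R none)) (funext fun s => ?_)
  change subst (Option.elim ((nfLeaves pre post).get s) _ leaf) R =
    Option.elim ((nfLeaves pre post).get s) (node i up) leaf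
  rcases (nfLeaves pre post).get s with _ | x
  · refine (h₂ _).trans (congrArg (node i) (funext fun j => ?_))
    exact h₃ j
  · rfl

end normalForm

/-- The contraction of subtrees. -/
theorem mk_eq_mk_of_subst {S : ℕ → Type s} {A : PlanarOperad.{w}} {n : ℕ} {I K : Type} [Finite I]
    [Finite K] {c : I → ℕ} {b : K → ℕ} (q : pOp.Op c n) (t : pOp.Op b n)
    (x : ∀ i, S (c i) ⊕ A.carrier (c i)) (z : ∀ k, S (b k) ⊕ A.carrier (b k))
    (R : ∀ i, PTree b (Fin (c i))) (ht : q.1.subst R = t.1)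
    (h : ∀ i, ∃ (J : Type) (_ : Finite J) (e : J → K) (r : pOp.Op (fun j => b (e j)) (c i)),
      r.1.map e b = R i ∧ Evaluates S A r (fun j => z (e j)) (x i)) :
    Quot.mk (Step (OperadHom.id pOp) S A) ⟨I, inferInstance, c, q, x⟩ =
      Quot.mk (Step (OperadHom.id pOp) S A) ⟨K, inferInstance, b, t, z⟩ := by
  choose J fJ e r hr hz using h
  let e' : (Σ i, J i) → K := fun y => e y.1 y.2
  have h₁ : (pOp.comp q r).1.map e' b = t.1 := by
    refine (PTree.map_comp e' b q.1 fun i => (r i).1).trans (Eq.trans ?_ ht)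
    exact congrArg q.1.subst (funext hr)
  -- The composite and `t` each contain every vertex mark exactly once, so the matching of vertices
  -- is forced to be bijective.
  have h₂ : Function.Bijective e' := by
    refine IsEnum.bijective (pOp.comp q r).2.1 ?_
    rw [← PTree.vertices_map e' b, h₁]
    exact t.2.1
  have h₃ := Quot.sound (Step.mk (f := OperadHom.id pOp) (Equiv.ofBijective e' h₂) c b q r x z hz)
  refine h₃.trans (congrArg (fun o => Quot.mk _ (⟨K, inferInstance, b, o, z⟩ :
    Expr pOp S A.carrier n)) (Subtype.ext h₁))

/-! ### Evaluation of trees -/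

namespace PTree

variable {I J L M X : Type}

/-- The value of a tree whose vertices are marked by functions on powers of `X`. -/
def eval {c : I → ℕ} (x : ∀ i, (Fin (c i) → X) → X) : PTree c L → (L → X) → X
  | leaf l, v => v l
  | node i ts, v => x i fun j => (ts j).eval x v

theorem eval_graft {c : I → ℕ} (x : ∀ i, (Fin (c i) → X) → X) (t : PTree c L)
    (g : L → PTree c M) (v : M → X) :
    (t.graft g).eval x v = t.eval x fun l => (g l).eval x v := by
  induction t with
  | leaf => rfl
  | node i ts ih => simp only [graft, eval, ih]

theorem eval_subst {c : I → ℕ} {b : J → ℕ} (x : ∀ j, (Fin (b j) → X) → X) (t : PTree c L)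
    (u : ∀ i, PTree b (Fin (c i))) (v : L → X) :
    (t.subst u).eval x v = t.eval (fun i => (u i).eval x) v := by
  induction t with
  | leaf => rfl
  | node i ts ih => simp only [subst, eval_graft, eval, ih]

theorem eval_map (e : I → J) (c : J → ℕ) (x : ∀ j, (Fin (c j) → X) → X)
    (t : PTree (fun i => c (e i)) L) (v : L → X) :
    (t.map e c).eval x v = t.eval (fun i => x (e i)) v := by
  induction t with
  | leaf => rfl
  | node i ts ih => simp only [map, eval, ih]

/-- By associativity of concatenation the value depends only on the leaves in planar order. This is
why the terminal planar operad acts on lists. -/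
theorem eval_flatMap {α : Type} {c : I → ℕ} (t : PTree c L) (v : L → List α) :
    t.eval (fun i w => (List.finRange (c i)).flatMap w) v = t.leaves.flatMap v := by
  induction t with
  | leaf => simp [eval, leaves]
  | node i ts ih => simp only [eval, leaves, ih, List.flatMap_assoc]

end PTree

/-- The planar operad of functions on powers of `X`. -/
def endOperad (X : Type) : PlanarOperad.{0} where
  carrier n := (Fin n → X) → X
  act t x := t.1.eval x
  act_one _ _ := rfl
  act_comp {I _ J _ c b d} p q x := funext fun v => by
    refine (PTree.eval_subst _ _ _ v).trans
      (congrArg (fun y => PTree.eval y p.1 v) (funext fun i => funext fun v' => ?_))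
    exact PTree.eval_map (fun j => (⟨i, j⟩ : Σ i, J i)) (fun y => b y.1 y.2) x (q i).1 v'
  act_relabel e c _ q x := funext fun v => PTree.eval_map e c x q.1 v

/-- The action of the terminal planar operad on a monoid of lists. -/
def concatHom (α : Type) :
    OpAlgHom uAsPl ((endOperad (List α)).res (OperadHom.id pOp)) where
  app {n} _ := fun v => (List.finRange n).flatMap v
  app_act q _ := funext fun v => by
    refine Eq.trans ?_ (PTree.eval_flatMap q.1 v).symm
    rw [q.2.2]

/-- The concatenation in which a letter is inserted at the position `i`. -/
def markAt (n i : ℕ) : (endOperad (List Bool)).carrier n := fun v =>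
  ((List.finRange n).take i).flatMap v ++ true :: ((List.finRange n).drop i).flatMap v

/-- On the inputs `[false]` the letter `true` appears at index `i`. The bounds matter, since `take`
stops at length `n`. -/
theorem markAt_injective {n i j : ℕ} (hi : i ≤ n) (hj : j ≤ n) (h : markAt n i = markAt n j) :
    i = j := by
  have key : ∀ k ≤ n, (markAt n k fun _ => [false]).idxOf true = k := by
    intro k hk
    have h₁ : ((List.finRange n).take k).flatMap (fun _ => [false]) = List.replicate k false := by
      refine (List.flatMap_pure_eq_map (fun _ => false) _).trans ?_
      rw [List.map_const']
      simp [hk]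
    rw [markAt, h₁, List.idxOf_append_of_notMem (by simp)]
    simp
  rw [← key i hi, h, key j hj]

/-- The morphism from `EO(uAsPl)` that sends the variables to `markAt`. -/
noncomputable def markHom (i : ℕ) : OpAlgHom (EO uAsPl) (endOperad (List Bool)) :=
  Adj.lift (fun n _ => markAt n i) (concatHom Bool)

theorem markHom_var (i n : ℕ) :
    (markHom i).app (Adj.var (OperadHom.id pOp) uAsPl (PUnit.unit : PUnit)) = markAt n i :=
  Adj.lift_var (f := OperadHom.id pOp) (B := endOperad (List Bool)) _ (concatHom Bool) _

theorem markHom_const (i : ℕ) {n : ℕ} (a : uAsPl.carrier n) :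
    (markHom i).app ((Adj.const (OperadHom.id pOp) _ uAsPl).app a) = (concatHom Bool).app a :=
  Adj.lift_const (f := OperadHom.id pOp) (B := endOperad (List Bool)) _ (concatHom Bool) _

/-- Marking gap `i` inside `x` amounts to marking gap `k` of the variable that `x` replaces. Thus
composition in the enveloping category becomes composition of maps between gaps. -/
theorem markHom_subst {m n i k : ℕ} (x : (EO uAsPl).carrier m) (y : (EO uAsPl).carrier n)
    (hx : (markHom i).app x = markAt m k) (hy : Adj.vars y = {⟨m, PUnit.unit⟩}) :
    (markHom i).app ((Adj.subst ⟨m, PUnit.unit⟩ x).app y) = (markHom k).app y := by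
  refine Adj.hom_congr ((Adj.subst ⟨m, PUnit.unit⟩ x).comp (markHom i)) (markHom k) y
    (fun a => ?_) fun t ht => ?_
  · refine (congrArg (markHom i).app (Adj.subst_const _ _ a)).trans ?_
    exact (markHom_const i a).trans (markHom_const k a).symm
  · rw [hy] at ht
    obtain rfl := Multiset.mem_singleton.1 ht
    refine (congrArg (markHom i).app (Adj.subst_var_self _ _)).trans (hx.trans ?_)
    exact (markHom_var k m).symm

/-! ### Normal forms in the enveloping category of the terminal planar operad -/

section normalForm

variable {n m : ℕ} (pre : List (Fin n)) (l : Fin m → List (Fin n)) (post : List (Fin n))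
  (h : pre ++ (List.finRange m).flatMap l ++ post = List.finRange n)

/-- The arguments of normal forms: there is one variable. -/
def nfArg : ∀ _ : Option (Option (Fin m)), PUnit.{1} ⊕ PUnit.{1}
  | some none => Sum.inl PUnit.unit
  | _ => Sum.inr PUnit.unit

/-- Normal forms with one variable. -/
def nfExpr : Expr pOp (fun _ => PUnit.{1}) uAsPl.carrier n :=
  ⟨Option (Option (Fin m)), inferInstance, nfArity pre l post,
    ⟨nfTree pre l post, isEnum_vertices_nfTree pre l post, (leaves_nfTree pre l post).trans h⟩,
    nfArg⟩

/-- The element represented by a normal form. -/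
def nf : (EO uAsPl).carrier n := Quot.mk _ (nfExpr pre l post h)

theorem nf_congr {pre pre' : List (Fin n)} {l l' : Fin m → List (Fin n)} {post post' : List (Fin n)}
    (h : pre ++ (List.finRange m).flatMap l ++ post = List.finRange n)
    (h' : pre' ++ (List.finRange m).flatMap l' ++ post' = List.finRange n)
    (h₁ : pre = pre') (h₂ : l = l') (h₃ : post = post') :
    nf pre l post h = nf pre' l' post' h' := by
  subst h₁ h₂ h₃
  rfl

theorem vars_mk_eq (E : Expr pOp (fun _ => PUnit.{1}) uAsPl.carrier n) [Fintype E.I] :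
    Adj.vars (f := OperadHom.id pOp) (A := uAsPl) (Quot.mk _ E : (EO uAsPl).carrier n) =
      ∑ i, Sum.elim (fun _ => ({⟨E.col i, PUnit.unit⟩} : Multiset (Σ _ : ℕ, PUnit.{1})))
        (fun _ => 0) (E.arg i) := by
  rw [Adj.mk_eq_act, Adj.vars, OpAlgHom.app_act]
  refine (finsum_eq_sum_of_fintype _).trans (Finset.sum_congr rfl fun i _ => ?_)
  change Adj.vars (Adj.gen _ _) = _
  rcases E.arg i with t | a
  · exact Adj.vars_var _
  · exact Adj.vars_const _

theorem vars_nf : Adj.vars (nf pre l post h) = {⟨m, PUnit.unit⟩} := by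
  let _ : Fintype (nfExpr pre l post h).I := inferInstanceAs (Fintype (Option (Option (Fin m))))
  refine (vars_mk_eq (nfExpr pre l post h)).trans
    ((Finset.sum_eq_single (some none) ?_ ?_).trans ?_)
  · rintro (_ | _ | j) - hj
    · rfl
    · exact (hj rfl).elim
    · rfl
  · exact fun hh => (hh (Finset.mem_univ _)).elim
  · rfl

/-- The letter inserted in gap `i` of the distinguished vertex is preceded by the leaves in `pre`
and those in the first `i` blocks. -/
theorem markHom_nf {i : ℕ} :
    (markHom i).app (nf pre l post h) =
      markAt n (pre ++ ((List.finRange m).take i).flatMap l).length := by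
  funext v
  have h₁ : (markHom i).app (nf pre l post h) v =
      pre.flatMap v ++ (markAt m i fun j => (l j).flatMap v) ++ post.flatMap v := by
    refine (flatMap_finRange_get (nfLeaves pre post)
      (fun x => PTree.eval _ (x.elim _ PTree.leaf) v)).trans ?_
    simp only [nfLeaves, List.flatMap_append, List.flatMap_cons, List.flatMap_map, Option.elim,
      PTree.eval, List.append_assoc]
    refine congrArg (fun y => pre.flatMap v ++ (y ++ post.flatMap v)) ?_
    refine congrArg (markAt m i) (funext fun j => ?_)
    exact flatMap_finRange_get (l j) v
  have h₂ : (pre ++ ((List.finRange m).take i).flatMap l) ++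
      (((List.finRange m).drop i).flatMap l ++ post) = List.finRange n := by
    rw [← h]
    conv_rhs => rw [← List.take_append_drop i (List.finRange m)]
    simp only [List.flatMap_append, List.append_assoc]
  rw [h₁, markAt, markAt, ← h₂, List.take_left, List.drop_left]
  simp only [List.flatMap_append, List.flatMap_assoc, List.append_assoc, List.cons_append]

/-- Every element with one variable is represented by a normal form. -/
theorem exists_eq_nf (x : (EO uAsPl).carrier n) (hx : Adj.vars x = {⟨m, PUnit.unit⟩}) :
    ∃ (pre : List (Fin n)) (l : Fin m → List (Fin n)) (post : List (Fin n))
      (h : pre ++ (List.finRange m).flatMap l ++ post = List.finRange n),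
      x = nf pre l post h := by
  classical
  induction x using Quot.ind with
  | mk E =>
  obtain ⟨K, fK, b, t, z⟩ := E
  let _ := Fintype.ofFinite K
  rw [vars_mk_eq] at hx
  dsimp only at hx t z
  obtain ⟨i, hi, hz⟩ : ∃ i, b i = m ∧ ∀ k, z k = if k = i then Sum.inl PUnit.unit
      else Sum.inr PUnit.unit := by
    have h₁ : (⟨m, PUnit.unit⟩ : Σ _ : ℕ, PUnit.{1}) ∈ ∑ i, Sum.elim
        (fun _ => ({⟨b i, PUnit.unit⟩} : Multiset (Σ _ : ℕ, PUnit.{1}))) (fun _ => 0) (z i) := by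
      rw [hx]
      exact Multiset.mem_singleton_self _
    obtain ⟨i, -, hi⟩ := Multiset.mem_sum.1 h₁
    have hzi : z i = Sum.inl PUnit.unit := by
      rcases hzi : z i with t | a
      · rfl
      · rw [hzi] at hi
        exact (Multiset.notMem_zero _ hi).elim
    rw [hzi] at hi
    have hm := congrArg Sigma.fst (Multiset.mem_singleton.1 hi)
    refine ⟨i, hm.symm, fun k => ?_⟩
    split_ifs with hk
    · rw [hk, hzi]; rfl
    -- Input `i` already accounts for the only variable, so the remaining inputs contribute a
    -- multiset of cardinality zero.
    · rw [← Finset.add_sum_erase _ _ (Finset.mem_univ i), hzi, Sum.elim_inl] at hx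
      have h₂ := congrArg Multiset.card hx
      rw [Multiset.card_add, Multiset.card_singleton, Multiset.card_singleton] at h₂
      have h₃ := Multiset.card_eq_zero.1 (Nat.add_eq_left.1 h₂)
      have h₄ := Finset.sum_eq_zero_iff.1 h₃ k (Finset.mem_erase.2 ⟨hk, Finset.mem_univ k⟩)
      rcases hzk : z k with t | a
      · rw [hzk] at h₄
        exact (Multiset.singleton_ne_zero _ h₄).elim
      · rfl
  subst hi
  obtain ⟨o, up, pre, post, ho, ht⟩ := PTree.exists_graft_eq t.1 i (t.2.1.2 i)
  -- The vertex `i` occurs once in `t`, and this occurrence is the distinguished one. The remaining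
  -- parts therefore carry constants only.
  have hv : i ∉ o.vertices ∧ ∀ j, i ∉ (up j).vertices := by
    have h₁ := (PTree.vertices_graft o fun x => x.elim (PTree.node i up) PTree.leaf)
    rw [← ht, ho] at h₁
    have h₂ := h₁.nodup_iff.1 t.2.1.1
    simp only [List.flatMap_append, List.flatMap_cons, Option.elim, PTree.vertices] at h₂
    rw [List.nodup_append] at h₂
    refine ⟨fun hi => h₂.2.2 i hi i (by simp) rfl, fun j hj => ?_⟩
    have h₃ := (List.nodup_append.1 (List.nodup_append.1 h₂.2.1).2.1).1
    exact (List.nodup_cons.1 h₃).1 (List.mem_flatMap.2 ⟨j, List.mem_finRange j, hj⟩)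
  have h : pre ++ (List.finRange (b i)).flatMap (fun j => (up j).leaves) ++ post =
      List.finRange n := by
    rw [← t.2.2, ht, PTree.leaves_graft, ho]
    simp only [List.flatMap_append, List.flatMap_cons, List.flatMap_map, Option.elim, PTree.leaves,
      List.append_assoc]
    simp
  refine ⟨pre, fun j => (up j).leaves, post, h, ?_⟩
  obtain ⟨r₀, hr₀, hr₀'⟩ := PTree.exists_mapLeaves_eq (nfLeaves pre post).get o (List.finRange _)
    (ho.trans (List.map_get_finRange (nfLeaves pre post)).symm)
  choose r hr hr' using fun j => PTree.exists_mapLeaves_eq (up j).leaves.get (up j)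
    (List.finRange _) (List.map_get_finRange (up j).leaves).symm
  -- The trees whose substitution into the normal form gives back `t`: the outer part, the
  -- distinguished vertex itself, and the part above each of its inputs.
  let R : ∀ k, PTree b (Fin (nfArity pre (fun j => (up j).leaves) post k))
    | none => r₀
    | some none => PTree.corolla b i
    | some (some j) => r j
  -- A tree that avoids `i` evaluates to the only constant of its arity, and so may be contracted to
  -- one vertex.
  have hR : ∀ {N : ℕ} (T : PTree b (Fin N)), T.leaves = List.finRange N →
      i ∉ T.vertices → ∃ (J : Type) (_ : Finite J) (e : J → K) (r : pOp.Op (fun j => b (e j)) N),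
      r.1.map e b = T ∧ Evaluates (fun _ => PUnit.{1}) uAsPl r (fun j => z (e j))
        (Sum.inr PUnit.unit) := by
    intro N T hT hiT
    obtain ⟨T', h₁, h₂⟩ := PTree.exists_map_eq T.vertices.get T (List.finRange _)
      (List.map_get_finRange T.vertices).symm
    refine ⟨Fin T.vertices.length, inferInstance, T.vertices.get,
      ⟨T', by rw [h₁]; exact isEnum_finRange _, by
        rw [← hT, ← PTree.leaves_map T.vertices.get b T', h₂]⟩, h₂, ?_⟩
    have h₃ : (fun j => z (T.vertices.get j)) = fun _ => Sum.inr PUnit.unit := by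
      funext j
      rw [hz, if_neg]
      exact fun e => hiT (e ▸ List.get_mem _ _)
    rw [h₃]
    exact Evaluates.const (A := uAsPl) _ fun _ => PUnit.unit
  refine (mk_eq_mk_of_subst (S := fun _ => PUnit.{1}) (A := uAsPl)
    (nfExpr pre _ post h).op t nfArg z R ?_ ?_).symm
  · exact (nfTree_subst pre _ post R o i up rfl hr₀' (fun _ => rfl) hr').trans ht.symm
  · rintro (_ | _ | j)
    · refine hR r₀ hr₀ ?_
      rw [← PTree.vertices_mapLeaves (nfLeaves pre post).get r₀, hr₀']
      exact hv.1
    · refine ⟨Unit, inferInstance, fun _ => i, pOp.one (b i), rfl, ?_⟩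
      have : (fun _ : Unit => z i) = fun _ => Sum.inl PUnit.unit := by
        funext
        rw [hz, if_pos rfl]
        rfl
      rw [this]
      exact Evaluates.var (A := uAsPl) _
    · refine hR (r j) (hr j) ?_
      rw [← PTree.vertices_mapLeaves (up j).leaves.get (r j), hr']
      exact hv.2 j

end normalForm
/-! ### Comparison with the simplex category -/

section comparison

variable {m n : ℕ}

/-- The blocks of `Fin n` that correspond to a monotone map. -/
theorem take_append_blocks (φ : Fin (m + 1) →o Fin (n + 1)) (i : Fin (m + 1)) :
    (List.finRange n).take (φ 0) ++ ((List.finRange m).take i).flatMap (fun j =>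
      ((List.finRange n).take (φ j.succ)).drop (φ j.castSucc)) = (List.finRange n).take (φ i) := by
  induction i using Fin.induction with
  | zero => simp
  | succ i ih =>
    have h₁ : (List.finRange m).take (i + 1) = (List.finRange m).take i ++ [i] := by
      rw [List.take_add_one]
      simp
    rw [Fin.val_succ, h₁, List.flatMap_append, ← List.append_assoc]
    rw [Fin.val_castSucc] at ih
    rw [ih, List.flatMap_cons, List.flatMap_nil, List.append_nil]
    have h₂ : (φ i.castSucc : ℕ) ≤ φ i.succ := φ.monotone (Fin.castSucc_lt_succ).le
    conv_rhs => rw [← List.take_append_drop (φ i.castSucc) ((List.finRange n).take (φ i.succ))]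
    rw [List.take_take, min_eq_left h₂]

theorem blocks_eq_finRange (φ : Fin (m + 1) →o Fin (n + 1)) :
    (List.finRange n).take (φ 0) ++ (List.finRange m).flatMap (fun j =>
      ((List.finRange n).take (φ j.succ)).drop (φ j.castSucc)) ++
        (List.finRange n).drop (φ (Fin.last m)) = List.finRange n := by
  have h := take_append_blocks φ (Fin.last m)
  rw [Fin.val_last, List.take_of_length_le (List.length_finRange (n := m)).le] at h
  rw [h, List.take_append_drop]

/-- The element of `EO(uAsPl)` that corresponds to a monotone map. -/
def nfOf (φ : Fin (m + 1) →o Fin (n + 1)) : (EO uAsPl).carrier n :=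
  nf _ _ _ (blocks_eq_finRange φ)

theorem markHom_nfOf (φ : Fin (m + 1) →o Fin (n + 1)) (i : Fin (m + 1)) :
    (markHom i).app (nfOf φ) = markAt n (φ i) := by
  refine (markHom_nf _ _ _ (blocks_eq_finRange φ)).trans ?_
  rw [take_append_blocks φ i, List.length_take, List.length_finRange,
    min_eq_left (Nat.lt_succ_iff.1 (φ i).2)]

/-- The blocks before cut `i` form a prefix `p i` of `List.finRange n`, which is determined by its
length. These lengths increase with `i` and are the values of `φ`; the blocks are recovered as
differences of successive prefixes. -/
theorem exists_eq_nfOf (x : (EO uAsPl).carrier n) (hx : Adj.vars x = {⟨m, PUnit.unit⟩}) :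
    ∃ φ : Fin (m + 1) →o Fin (n + 1), x = nfOf φ := by
  obtain ⟨pre, l, post, h, rfl⟩ := exists_eq_nf x hx
  let p : ℕ → List (Fin n) := fun i => pre ++ ((List.finRange m).take i).flatMap l
  have hp : ∀ i, p i <+: List.finRange n := fun i => by
    refine ⟨((List.finRange m).drop i).flatMap l ++ post, ?_⟩
    rw [← h]
    conv_rhs => rw [← List.take_append_drop i (List.finRange m)]
    simp only [p, List.flatMap_append, List.append_assoc]
  have hmono : Monotone fun i => (p i).length := monotone_nat_of_le_succ fun i => by
    refine List.IsPrefix.length_le ?_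
    refine (List.prefix_append_right_inj pre).2 ?_
    obtain ⟨r, hr⟩ := List.take_prefix_take_left (l := List.finRange m) (Nat.le_succ i)
    rw [← hr, List.flatMap_append]
    exact List.prefix_append _ _
  let φ : Fin (m + 1) →o Fin (n + 1) :=
    ⟨fun i => ⟨(p i).length, Nat.lt_succ_of_le (by simpa using (hp i).length_le)⟩,
      fun i j hij => hmono hij⟩
  have hφ : ∀ i : Fin (m + 1), p i = (List.finRange n).take (φ i) := fun i =>
    List.prefix_iff_eq_take.1 (hp i)
  have h0 : p (0 : Fin (m + 1)) = pre := by simp [p]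
  have hlast : p (Fin.last m) = pre ++ (List.finRange m).flatMap l := by
    simp only [p, Fin.val_last]
    rw [List.take_of_length_le (List.length_finRange (n := m)).le]
  refine ⟨φ, nf_congr _ _ (h0.symm.trans (hφ 0)) (funext fun j => ?_) ?_⟩
  · have h₁ : p j.succ = p j.castSucc ++ l j := by
      have h₂ : (List.finRange m).take (j + 1) = (List.finRange m).take j ++ [j] := by
        rw [List.take_add_one]
        simp
      simp only [p, Fin.val_succ, Fin.val_castSucc, h₂, List.flatMap_append, List.append_assoc]
      simp
    rw [← hφ j.succ, h₁]
    exact (List.drop_left (l₁ := p j.castSucc) (l₂ := l j)).symm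
  · rw [← h, ← hlast]
    exact (List.drop_left (l₁ := p (Fin.last m)) (l₂ := post)).symm

theorem vars_nfOf (φ : Fin (m + 1) →o Fin (n + 1)) : Adj.vars (nfOf φ) = {⟨m, PUnit.unit⟩} :=
  vars_nf _ _ _ _

theorem eq_of_markAt_eq {φ ψ : Fin (m + 1) →o Fin (n + 1)}
    (h : ∀ i, markAt n (φ i) = markAt n (ψ i)) : φ = ψ :=
  OrderHom.ext _ _ (funext fun i => Fin.ext
    (markAt_injective (Nat.lt_succ_iff.1 (φ i).2) (Nat.lt_succ_iff.1 (ψ i).2) (h i)))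

theorem nfOf_injective : Function.Injective (nfOf (m := m) (n := n)) := fun φ ψ h =>
  eq_of_markAt_eq fun i => by rw [← markHom_nfOf, ← markHom_nfOf, h]

/-- No expressions are reduced: the variable is some `nfOf φ` by `exists_eq_nfOf`, and its action on
lists identifies `φ`. -/
theorem nfOf_id : nfOf (OrderHom.id (α := Fin (n + 1))) =
    Adj.var (OperadHom.id pOp) uAsPl (PUnit.unit : PUnit) := by
  obtain ⟨φ, hφ⟩ := exists_eq_nfOf (m := n) _ (Adj.vars_var (f := OperadHom.id pOp) (A := uAsPl)
    (S := fun _ => PUnit.{1}) (c := n) PUnit.unit)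
  refine Eq.trans (congrArg nfOf (eq_of_markAt_eq fun i => ?_)) hφ.symm
  rw [← markHom_nfOf φ, ← hφ]
  exact (markHom_var i n).symm

/-- The composite has one variable, hence is some `nfOf χ`; `markHom_subst` shows that it moves gap
`i` to `ψ (φ i)`. -/
theorem nfOf_comp {k : ℕ} (φ : Fin (m + 1) →o Fin (n + 1)) (ψ : Fin (n + 1) →o Fin (k + 1)) :
    nfOf (ψ.comp φ) = (Adj.subst ⟨n, PUnit.unit⟩ (nfOf φ)).app (nfOf ψ) := by
  obtain ⟨χ, hχ⟩ := exists_eq_nfOf (m := m) ((Adj.subst ⟨n, PUnit.unit⟩ (nfOf φ)).app (nfOf ψ))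
    ((Adj.vars_subst _ _ _ (vars_nfOf ψ)).trans (vars_nfOf φ))
  refine Eq.trans (congrArg nfOf (eq_of_markAt_eq fun i => ?_)) hχ.symm
  rw [← markHom_nfOf χ, ← hχ]
  exact ((markHom_subst _ _ (markHom_nfOf φ i) (vars_nfOf ψ)).trans (markHom_nfOf ψ (φ i))).symm

end comparison

/-- The comparison functor from the simplex category to the enveloping category. -/
noncomputable def simplexToEnv : SimplexCategory ⥤ Env uAsPl where
  obj x := x.len
  map φ := ⟨nfOf φ.toOrderHom, vars_nfOf _⟩
  map_id _ := Subtype.ext nfOf_id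
  map_comp φ ψ := Subtype.ext (nfOf_comp φ.toOrderHom ψ.toOrderHom)

/-- The comparison functor from the simplex category to the twisted arrow category. -/
noncomputable def simplexToTw : SimplexCategory ⥤ Tw uAsPl where
  obj x := ⟨x.len, PUnit.unit⟩
  -- `uAsPl` has one element of each colour, so `TO uAsPl` and `EO uAsPl` have the same variables,
  -- and the condition on the value holds trivially.
  map φ := ⟨nfOf φ.toOrderHom, vars_nfOf _, rfl⟩
  map_id _ := Subtype.ext nfOf_id
  map_comp φ ψ := Subtype.ext (nfOf_comp φ.toOrderHom ψ.toOrderHom)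

instance : simplexToEnv.Faithful where
  map_injective h := SimplexCategory.Hom.ext _ _ (nfOf_injective (congrArg Subtype.val h))

instance : simplexToEnv.Full where
  map_surjective x := by
    obtain ⟨φ, hφ⟩ := exists_eq_nfOf x.1 x.2
    exact ⟨SimplexCategory.Hom.mk φ, Subtype.ext hφ.symm⟩

instance : simplexToTw.Faithful where
  map_injective h := SimplexCategory.Hom.ext _ _ (nfOf_injective (congrArg Subtype.val h))

instance : simplexToTw.Full where
  map_surjective x := by
    obtain ⟨φ, hφ⟩ := exists_eq_nfOf x.1 x.2.1
    exact ⟨SimplexCategory.Hom.mk φ, Subtype.ext hφ.symm⟩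

/-- A fully faithful functor that is bijective on objects is an isomorphism of categories. -/
theorem IsomorphicCategories.of_fullyFaithful {X : Type u} [Category.{v} X] {Y : Type u'}
    [Category.{v'} Y] (G : Y ⥤ X) [G.Full] [G.Faithful] (o : X → Y) (h₁ : ∀ x, G.obj (o x) = x)
    (h₂ : ∀ y, o (G.obj y) = y) : IsomorphicCategories X Y := by
  let F : X ⥤ Y :=
    { obj := o
      -- The objects `G.obj (o x)` and `x` are equal only by `h₁`, so `f` is transported before its
      -- preimage is taken.
      map := fun {x x'} f => G.preimage (eqToHom (h₁ x) ≫ f ≫ eqToHom (h₁ x').symm)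
      map_id := fun x => G.map_injective (by simp)
      map_comp := fun f g => G.map_injective (by simp) }
  refine ⟨F, G, CategoryTheory.Functor.ext h₁ fun x x' f => ?_,
    CategoryTheory.Functor.ext h₂ fun y y' f => G.map_injective ?_⟩
  · simp [F]
  · simp [F, eqToHom_map]

theorem isomorphicCategories_tw : IsomorphicCategories (Tw uAsPl) SimplexCategory :=
  .of_fullyFaithful simplexToTw (fun x => SimplexCategory.mk x.1) (fun _ => rfl) fun _ => rfl

theorem isomorphicCategories_env : IsomorphicCategories (Env uAsPl) SimplexCategory :=
  .of_fullyFaithful simplexToEnv (fun x : ℕ => SimplexCategory.mk x) (fun _ => rfl) fun _ => rfl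

theorem IsomorphicCategories.equivalence {X : Type u} [Category.{v} X] {Y : Type u'}
    [Category.{v'} Y] (h : IsomorphicCategories X Y) : Nonempty (X ≌ Y) := by
  obtain ⟨F, G, h₁, h₂⟩ := h
  exact ⟨CategoryTheory.Equivalence.mk F G (eqToIso h₁.symm) (eqToIso h₂)⟩

theorem nonempty_tw_uAs_equivalence : Nonempty (Tw uAs ≌ SimplexCategory) := by
  have := twSym_isEquivalence uAsPl
  obtain ⟨e⟩ := isomorphicCategories_tw.equivalence
  exact ⟨(twSym uAsPl).asEquivalence.symm.trans e⟩

end TwArr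

theorem mainTheorem6 :
    TwArr.IsomorphicCategories (TwArr.Tw TwArr.uAsPl) SimplexCategory ∧
    TwArr.IsomorphicCategories (TwArr.Env TwArr.uAsPl) SimplexCategory ∧
    (∀ P : TwArr.PlanarOperad.{w}, (TwArr.twSym P).IsEquivalence) ∧
    Nonempty (TwArr.Tw TwArr.uAs ≌ SimplexCategory) :=
  ⟨TwArr.isomorphicCategories_tw, TwArr.isomorphicCategories_env, TwArr.twSym_isEquivalence,
    TwArr.nonempty_tw_uAs_equivalence⟩
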